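/- Let $E: y^2+a_1xy+a_3y=x^3+a_2x^2+a_4x+a_6$ be an elliptic curve over $\mathbb{Q}$ given by a global minimal Weierstrass equation (with $a_i\in\mathbb{Z}$), with invariants $c_4,c_6,\Delta$, and let $d$ be a square-free integer. Let $E^d$ be the twisted equation $$y^2+a_1xy+a_3y=x^3+\Big(a_2d+a_1^2\tfrac{d-1}{4}\Big)x^2+\Big(a_4d^2+a_1a_3\tfrac{d^2-1}{2}\Big)x+\Big(a_6d^3+a_3^2\tfrac{d^3-1}{4}\Big).$$ A transformation $[u,r,s,t]$ from one Weierstrass equation (coordinates $x,y$) to another (coordinates $x',y'$) is $x=u^2x'+r$, $y=u^3y'+u^2sx'+t$. For a Weierstrass equation $F$ with coefficients $a_i(F)$ put $\omega(F)=dx/(2y+a_1(F)x+a_3(F))$. Write $v_p$ for the $p$-adic valuation ($v_p(0)=\infty$), call $(v_2(c_4),v_2(c_6),v_2(\Delta))$ the 2-adic signature of $E$, and define $\tilde u=\prod_p u_p$, where: 1. If $p$ is an odd prime dividing $d$: $u_p=1$ if $\min\{3v_p(c_4),2v_p(c_6),v_p(\Delta)\}<6$, or if $p=3$ and $v_3(c_6)=5$;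 otherwise $u_p=p$. If $p$ is an odd prime not dividing $d$: $u_p=1$. 2. If $p=2$: (a) if $d\equiv1\pmod 4$, then $u_2=1$; (b) if $d\equiv3\pmod 4$, then $u_2=1/2$ if the 2-adic signature is $(0,0,c)$ with $c\ge0$, or $(a,3,0)$ with $4\le a\le\infty$; $u_2=2$ if it is $(4,6,c)$ with $c\ge12$ and $2^{-6}c_6d\equiv-1\pmod 4$, or $(a,9,12)$ with $a\ge8$ and $2^{-9}c_6d\equiv1\pmod 4$; otherwise $u_2=1$; (c) if $d\equiv2\pmod 4$ and $w=d/2$, then $u_2=1/2$ if the 2-adic signature is $(0,0,c)$ with $c\ge0$; $u_2=4$ if it is $(6,9,c)$ with $c\ge18$ and $2^{-9}c_6w\equiv-1\pmod 4$; $u_2=1$ if $v_2(c_4)\in\{4,5\}$, or $v_2(c_6)\in\{3,5,7\}$, or the signature is $(a,6,6)$ with $a\ge6$ and $2^{-6}c_6w\equiv-1\pmod 4$; otherwise $u_2=2$. Let $K\supseteq\mathbb{Q}$ be a field containing a square root $\sqrt d$ of $d$, and put $\alpha=1/\sqrt d$. Over $K$, the transformation $x=\alpha^2x'$, $y=\alpha^3y'+\frac{a_1\alpha^2(\alpha-1)}2x'+\frac{a_3(\alpha^3-1)}2$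 takes $E$ to $E^d$. Identifying differentials on the two curves by pulling back along the corresponding isomorphism $E\to E^d$, one has $$\omega(E^d)=\frac{\omega(E)}{\sqrt d}.$$ Moreover, there are $r,s,t\in\mathbb{Q}$ such that the transformation $[\tilde u,r,s,t]$ takes $E^d$ to a global minimal Weierstrass equation; and for every such $r,s,t$, if $E^d_{\min}$ denotes the resulting minimal equation, pulling back along the composite $E\to E^d\to E^d_{\min}$ gives $$\omega(E^d_{\min})=\frac{\tilde u\cdot\omega(E)}{\sqrt d}.$$ -/

import Mathlib

open scoped Polynomial

noncomputable section

namespace WeierstrassCurve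

/-! ### Isomorphisms of Weierstrass curves on coordinate rings and function fields -/

section Coordinates

variable {R : Type*} [CommRing R]

/-- The coordinate function `x` in the affine coordinate ring. -/
def coordX (W : WeierstrassCurve R) : W.toAffine.CoordinateRing :=
  Affine.CoordinateRing.mk W.toAffine (Polynomial.C Polynomial.X)

/-- The coordinate function `y` in the affine coordinate ring. -/
def coordY (W : WeierstrassCurve R) : W.toAffine.CoordinateRing :=
  Affine.CoordinateRing.mk W.toAffine Polynomial.X

/-- The Weierstrass equation of `W`, with coefficients in an `R`-algebra `A`. -/
def EquationIn (W : WeierstrassCurve R) {A : Type*} [CommRing A] [Algebra R A] (x y : A) : Prop :=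
  y ^ 2 + algebraMap R A W.a₁ * x * y + algebraMap R A W.a₃ * y =
    x ^ 3 + algebraMap R A W.a₂ * x ^ 2 + algebraMap R A W.a₄ * x + algebraMap R A W.a₆

theorem equationIn_coord (W : WeierstrassCurve R) : W.EquationIn W.coordX W.coordY := by
  have h : Affine.CoordinateRing.mk W.toAffine W.toAffine.polynomial = 0 := AdjoinRoot.mk_self
  have hC : ∀ a : R, algebraMap R W.toAffine.CoordinateRing a =
      Affine.CoordinateRing.mk W.toAffine (Polynomial.C (Polynomial.C a)) := fun _ => rfl
  unfold EquationIn coordX coordY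
  simp only [Affine.polynomial, map_sub, map_add, map_mul, map_pow] at h
  simp only [hC]
  linear_combination h

/-- The `R`-algebra homomorphism out of the coordinate ring given by a solution of the equation. -/
def coordLift (W : WeierstrassCurve R) {A : Type*} [CommRing A] [Algebra R A] {x y : A}
    (h : W.EquationIn x y) : W.toAffine.CoordinateRing →ₐ[R] A where
  toRingHom := AdjoinRoot.lift (Polynomial.aeval x : R[X] →ₐ[R] A).toRingHom y (by
    simp only [EquationIn] at h
    simp [Affine.polynomial, Polynomial.eval₂_add, Polynomial.eval₂_mul, Polynomial.eval₂_pow]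
    linear_combination h)
  commutes' a := by
    have : algebraMap R W.toAffine.CoordinateRing a =
      AdjoinRoot.of W.toAffine.polynomial (Polynomial.C a) := rfl
    simp [this]

@[simp] theorem coordLift_coordX (W : WeierstrassCurve R) {A : Type*} [CommRing A] [Algebra R A]
    {x y : A} (h : W.EquationIn x y) : W.coordLift h W.coordX = x := by
  have : W.coordX = AdjoinRoot.of W.toAffine.polynomial Polynomial.X := rfl
  simp [coordLift, this]

@[simp] theorem coordLift_coordY (W : WeierstrassCurve R) {A : Type*} [CommRing A] [Algebra R A]
    {x y : A} (h : W.EquationIn x y) : W.coordLift h W.coordY = y := by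
  have : W.coordY = AdjoinRoot.root W.toAffine.polynomial := rfl
  simp [coordLift, this]

theorem coordHom_ext (W : WeierstrassCurve R) {A : Type*} [CommRing A] [Algebra R A]
    {f g : W.toAffine.CoordinateRing →ₐ[R] A} (hx : f W.coordX = g W.coordX)
    (hy : f W.coordY = g W.coordY) : f = g := by
  apply AlgHom.coe_ringHom_injective
  apply AdjoinRoot.ringHom_ext
  · apply Polynomial.ringHom_ext
    · intro a
      exact (f.commutes a).trans (g.commutes a).symm
    · exact hx
  · exact hy

end Coordinates

section Pullback

variable {F : Type*} [Field F]

/-- For a change of variables `x = u²x' + r`, `y = u³y' + u²sx' + t` transforming the equation `W`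
into `W'`, the coordinates `x'`, `y'` as functions on `W` satisfy the equation of `W'`. -/
theorem equationIn_new (W W' : WeierstrassCurve F) (C : VariableChange F) (h : C • W = W') :
    W'.EquationIn
      (algebraMap F W.toAffine.CoordinateRing ((C.u⁻¹ : Fˣ) ^ 2) *
        (W.coordX - algebraMap F _ C.r))
      (algebraMap F W.toAffine.CoordinateRing ((C.u⁻¹ : Fˣ) ^ 3) *
        (W.coordY - algebraMap F _ C.s * (W.coordX - algebraMap F _ C.r) -
          algebraMap F _ C.t)) := by
  have e := W.equationIn_coord
  subst h
  simp only [EquationIn, variableChange_def, map_mul, map_add, map_sub, map_pow, map_ofNat] at e ⊢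
  linear_combination (algebraMap F W.toAffine.CoordinateRing ((C.u⁻¹ : Fˣ))) ^ 6 * e

theorem equationIn_old (W W' : WeierstrassCurve F) (C : VariableChange F) (h : C • W = W') :
    W.EquationIn
      (algebraMap F W'.toAffine.CoordinateRing ((C.u : F) ^ 2) * W'.coordX + algebraMap F _ C.r)
      (algebraMap F W'.toAffine.CoordinateRing ((C.u : F) ^ 3) * W'.coordY +
        algebraMap F _ ((C.u : F) ^ 2 * C.s) * W'.coordX + algebraMap F _ C.t) := by
  have e := W'.equationIn_coord
  have h' : W = C⁻¹ • W' := by rw [← h, inv_smul_smul]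
  have hu : (C.u : F) * (C.u⁻¹ : Fˣ) = 1 := by simp
  have hU : algebraMap F W'.toAffine.CoordinateRing C.u *
      algebraMap F W'.toAffine.CoordinateRing (C.u⁻¹ : Fˣ) = 1 := by
    rw [← map_mul, hu, map_one]
  obtain ⟨b₁, b₂, b₃, b₄, b₆⟩ : W'.a₁ * C.u = W.a₁ + 2 * C.s ∧
      W'.a₂ * C.u ^ 2 = W.a₂ - C.s * W.a₁ + 3 * C.r - C.s ^ 2 ∧
      W'.a₃ * C.u ^ 3 = W.a₃ + C.r * W.a₁ + 2 * C.t ∧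
      W'.a₄ * C.u ^ 4 = W.a₄ - C.s * W.a₃ + 2 * C.r * W.a₂ - (C.t + C.r * C.s) * W.a₁ +
        3 * C.r ^ 2 - 2 * C.s * C.t ∧
      W'.a₆ * C.u ^ 6 = W.a₆ + C.r * W.a₄ + C.r ^ 2 * W.a₂ + C.r ^ 3 - C.t * W.a₃ - C.t ^ 2 -
        C.r * C.t * W.a₁ := by
    subst h
    have hu0 : (C.u : F) ≠ 0 := C.u.ne_zero
    simp only [variableChange_def, Units.val_inv_eq_inv_val]
    refine ⟨?_, ?_, ?_, ?_, ?_⟩ <;> field_simp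
  apply_fun algebraMap F W'.toAffine.CoordinateRing at b₁ b₂ b₃ b₄ b₆
  simp only [EquationIn, map_mul, map_add, map_sub, map_pow, map_ofNat] at e b₁ b₂ b₃ b₄ b₆ ⊢
  set x := W'.coordX
  set y := W'.coordY
  set u := algebraMap F W'.toAffine.CoordinateRing C.u
  linear_combination u ^ 6 * e - u ^ 5 * x * y * b₁ + u ^ 4 * x ^ 2 * b₂ - u ^ 3 * y * b₃ +
    u ^ 2 * x * b₄ + b₆

/-- The isomorphism of affine coordinate rings `F[W'] ≃ F[W]` (composition of functions on `W'`
with the isomorphism of curves `W → W'`) given by a change of variables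
`x = u²x' + r`, `y = u³y' + u²sx' + t` transforming the equation `W` into `W'`. It sends `x'` to
`u⁻²(x - r)` and `y'` to `u⁻³(y - s(x - r) - t)`. -/
def coordEquiv (W W' : WeierstrassCurve F) (C : VariableChange F) (h : C • W = W') :
    W'.toAffine.CoordinateRing ≃ₐ[F] W.toAffine.CoordinateRing :=
  AlgEquiv.ofAlgHom (W'.coordLift (equationIn_new W W' C h)) (W.coordLift (equationIn_old W W' C h))
    (by
      have hU : algebraMap F W.toAffine.CoordinateRing C.u *
          algebraMap F W.toAffine.CoordinateRing (C.u⁻¹ : Fˣ) = 1 := by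
        rw [← map_mul, Units.mul_inv, map_one]
      set u := algebraMap F W.toAffine.CoordinateRing C.u
      set v := algebraMap F W.toAffine.CoordinateRing (C.u⁻¹ : Fˣ)
      have hU2 : u ^ 2 * v ^ 2 = 1 := by rw [← mul_pow, hU, one_pow]
      have hU3 : u ^ 3 * v ^ 3 = 1 := by rw [← mul_pow, hU, one_pow]
      apply coordHom_ext
      · simp only [AlgHom.comp_apply, coordLift_coordX, map_add, map_mul, AlgHom.commutes,
          AlgHom.id_apply, map_pow]
        linear_combination (W.coordX - algebraMap F _ C.r) * hU2
      · simp only [AlgHom.comp_apply, coordLift_coordX, coordLift_coordY, map_add, map_mul,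
          AlgHom.commutes, AlgHom.id_apply, map_pow]
        linear_combination (W.coordY - algebraMap F _ C.s * (W.coordX - algebraMap F _ C.r) -
          algebraMap F _ C.t) * hU3 + algebraMap F _ C.s * (W.coordX - algebraMap F _ C.r) * hU2)
    (by
      have hU : algebraMap F W'.toAffine.CoordinateRing C.u *
          algebraMap F W'.toAffine.CoordinateRing (C.u⁻¹ : Fˣ) = 1 := by
        rw [← map_mul, Units.mul_inv, map_one]
      set u := algebraMap F W'.toAffine.CoordinateRing C.u
      set v := algebraMap F W'.toAffine.CoordinateRing (C.u⁻¹ : Fˣ)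
      have hU2 : u ^ 2 * v ^ 2 = 1 := by rw [← mul_pow, hU, one_pow]
      have hU3 : u ^ 3 * v ^ 3 = 1 := by rw [← mul_pow, hU, one_pow]
      apply coordHom_ext
      · simp only [AlgHom.comp_apply, coordLift_coordX, map_sub, map_mul,
          AlgHom.commutes, AlgHom.id_apply, map_pow]
        linear_combination W'.coordX * hU2
      · simp only [AlgHom.comp_apply, coordLift_coordX, coordLift_coordY, map_sub,
          map_mul, AlgHom.commutes, AlgHom.id_apply, map_pow]
        linear_combination W'.coordY * hU3)

/-- The induced isomorphism of function fields `F(W') ≃ F(W)`. -/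
def functionFieldEquiv (W W' : WeierstrassCurve F) (C : VariableChange F) (h : C • W = W') :
    W'.toAffine.FunctionField ≃ₐ[F] W.toAffine.FunctionField :=
  IsFractionRing.fieldEquivOfAlgEquiv F W'.toAffine.FunctionField W.toAffine.FunctionField
    (coordEquiv W W' C h)

/-- The map on Kähler differentials induced by a homomorphism of `F`-algebras. -/
def kaehlerMap {A B : Type*} [CommRing A] [CommRing B] [Algebra F A] [Algebra F B]
    (φ : A →ₐ[F] B) : KaehlerDifferential F A →ₗ[F] KaehlerDifferential F B :=
  letI : Algebra A B := φ.toRingHom.toAlgebra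
  haveI : IsScalarTower F A B := IsScalarTower.of_algebraMap_eq fun a => (φ.commutes a).symm
  (KaehlerDifferential.map F F A B).restrictScalars F

/-- The pullback of differentials from `W'` to `W` along the isomorphism of curves `W → W'` given
by a change of variables transforming the equation `W` into `W'`. -/
def pullback (W W' : WeierstrassCurve F) (C : VariableChange F) (h : C • W = W') :
    KaehlerDifferential F W'.toAffine.FunctionField →ₗ[F]
      KaehlerDifferential F W.toAffine.FunctionField :=
  kaehlerMap (functionFieldEquiv W W' C h : W'.toAffine.FunctionField →ₐ[F] _)

/-- The invariant differential `dx / (2y + a₁x + a₃)`, as a Kähler differential of the function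
field. -/
def invariantDifferential (W : WeierstrassCurve F) :
    KaehlerDifferential F W.toAffine.FunctionField :=
  (algebraMap W.toAffine.CoordinateRing W.toAffine.FunctionField
      (2 * W.coordY + algebraMap F _ W.a₁ * W.coordX + algebraMap F _ W.a₃))⁻¹ •
    KaehlerDifferential.D F W.toAffine.FunctionField
      (algebraMap W.toAffine.CoordinateRing W.toAffine.FunctionField W.coordX)

end Pullback

/-! ### Global minimality over `ℚ` -/

/-- All coefficients of `W` are `p`-integral. -/
def IsIntegralAt (p : ℕ) (W : WeierstrassCurve ℚ) : Prop :=
  ¬ p ∣ W.a₁.den ∧ ¬ p ∣ W.a₂.den ∧ ¬ p ∣ W.a₃.den ∧ ¬ p ∣ W.a₄.den ∧ ¬ p ∣ W.a₆.den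

/-- A global minimal Weierstrass equation over `ℚ` of an elliptic curve: the coefficients are
integers, and for every prime `p` the `p`-adic valuation of the discriminant cannot be decreased by
a change of variables over `ℚ` leading to an equation with `p`-integral coefficients. -/
structure IsGlobalMinimal (W : WeierstrassCurve ℚ) : Prop where
  isElliptic : W.IsElliptic
  isIntegral : W.IsIntegral ℤ
  minimal : ∀ p : ℕ, p.Prime → ∀ C : VariableChange ℚ, (C • W).IsIntegralAt p →
    padicValRat p W.Δ ≤ padicValRat p (C • W).Δ

/-! ### Quadratic twists -/

/-- The twisted equation
`y² + a₁xy + a₃y = x³ + (a₂d + a₁²(d-1)/4)x² + (a₄d² + a₁a₃(d²-1)/2)x + (a₆d³ + a₃²(d³-1)/4)`. -/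
def quadraticTwist (W : WeierstrassCurve ℚ) (d : ℤ) : WeierstrassCurve ℚ where
  a₁ := W.a₁
  a₂ := W.a₂ * d + W.a₁ ^ 2 * ((d - 1) / 4)
  a₃ := W.a₃
  a₄ := W.a₄ * d ^ 2 + W.a₁ * W.a₃ * ((d ^ 2 - 1) / 2)
  a₆ := W.a₆ * d ^ 3 + W.a₃ ^ 2 * ((d ^ 3 - 1) / 4)

/-- With `α = 1/δ`, `δ² = d`, the transformation `x = α²x'`,
`y = α³y' + (a₁α²(α - 1)/2)x' + a₃(α³ - 1)/2` from `W` to its twist by `d`. -/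
def twistChange (W : WeierstrassCurve ℚ) {K : Type*} [Field K] [Algebra ℚ K] (δ : Kˣ) :
    VariableChange K where
  u := δ⁻¹
  r := 0
  s := algebraMap ℚ K W.a₁ * ((δ : K)⁻¹ - 1) / 2
  t := algebraMap ℚ K W.a₃ * ((δ : K)⁻¹ ^ 3 - 1) / 2

theorem twistChange_smul (W : WeierstrassCurve ℚ) {K : Type*} [Field K] [Algebra ℚ K] (d : ℤ)
    (δ : Kˣ) (hδ : (δ : K) ^ 2 = d) :
    W.twistChange δ • W.baseChange K = (W.quadraticTwist d).baseChange K := by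
  have : CharZero K := algebraRat.charZero K
  have h0 : (δ : K) ≠ 0 := δ.ne_zero
  ext <;> simp only [variableChange_def, twistChange, quadraticTwist, baseChange, map_a₁, map_a₂,
    map_a₃, map_a₄, map_a₆, inv_inv, map_add, map_mul, map_div₀, map_sub, map_pow, map_intCast,
    map_one, map_ofNat, ← hδ] <;> field_simp <;> ring

/-! ### The scaling factor of the minimal model of a twist -/

section Factor

/-- The `p`-adic valuation of an integer, equal to `∞` at `0`. -/
def pval (p : ℕ) (n : ℤ) : ℕ∞ := emultiplicity (p : ℤ) n

open Classical in
/-- The local factor `u_p` at an odd prime `p`. -/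
def oddFactor (E : WeierstrassCurve ℤ) (d : ℤ) (p : ℕ) : ℚ :=
  if (p : ℤ) ∣ d then
    if min (3 * pval p E.c₄) (min (2 * pval p E.c₆) (pval p E.Δ)) < 6 ∨
        (p = 3 ∧ pval p E.c₆ = 5) then 1
    else p
  else 1

open Classical in
/-- The local factor `u_2`. -/
def evenFactor (E : WeierstrassCurve ℤ) (d : ℤ) : ℚ :=
  if d ≡ 1 [ZMOD 4] then 1
  else if d ≡ 3 [ZMOD 4] then
    if (pval 2 E.c₄ = 0 ∧ pval 2 E.c₆ = 0) ∨
        (4 ≤ pval 2 E.c₄ ∧ pval 2 E.c₆ = 3 ∧ pval 2 E.Δ = 0) then 1 / 2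
    else if (pval 2 E.c₄ = 4 ∧ pval 2 E.c₆ = 6 ∧ 12 ≤ pval 2 E.Δ ∧
          E.c₆ / 2 ^ 6 * d ≡ -1 [ZMOD 4]) ∨
        (8 ≤ pval 2 E.c₄ ∧ pval 2 E.c₆ = 9 ∧ pval 2 E.Δ = 12 ∧
          E.c₆ / 2 ^ 9 * d ≡ 1 [ZMOD 4]) then 2
    else 1
  else
    -- here `d ≡ 2 mod 4`, since `d` is square-free
    if pval 2 E.c₄ = 0 ∧ pval 2 E.c₆ = 0 then 1 / 2
    else if pval 2 E.c₄ = 6 ∧ pval 2 E.c₆ = 9 ∧ 18 ≤ pval 2 E.Δ ∧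
        E.c₆ / 2 ^ 9 * (d / 2) ≡ -1 [ZMOD 4] then 4
    else if (pval 2 E.c₄ = 4 ∨ pval 2 E.c₄ = 5) ∨
        (pval 2 E.c₆ = 3 ∨ pval 2 E.c₆ = 5 ∨ pval 2 E.c₆ = 7) ∨
        (6 ≤ pval 2 E.c₄ ∧ pval 2 E.c₆ = 6 ∧ pval 2 E.Δ = 6 ∧
          E.c₆ / 2 ^ 6 * (d / 2) ≡ -1 [ZMOD 4]) then 1
    else 2

/-- The local factor `u_p` at a prime `p`. -/
def localFactor (E : WeierstrassCurve ℤ) (d : ℤ) (p : ℕ) : ℚ :=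
  if p = 2 then evenFactor E d else oddFactor E d p

theorem localFactor_ne_zero (E : WeierstrassCurve ℤ) (d : ℤ) {p : ℕ} (hp : p.Prime) :
    localFactor E d p ≠ 0 := by
  have := hp.ne_zero
  unfold localFactor evenFactor oddFactor
  split_ifs <;> first | exact_mod_cast this | norm_num

/-- The factor `ũ = ∏ u_p`. The product is over the primes dividing `2d`, since `u_p = 1` for
every other prime. -/
def twistFactor (E : WeierstrassCurve ℤ) (d : ℤ) : ℚˣ :=
  Units.mk0 (∏ p ∈ (2 * d).natAbs.primeFactors, localFactor E d p)
    (Finset.prod_ne_zero_iff.mpr fun _ hp =>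
      localFactor_ne_zero E d (Nat.prime_of_mem_primeFactors hp))

/-- The transformation `[ũ, r, s, t]` applied to the twisted equation. -/
def twistModel (E : WeierstrassCurve ℤ) (d : ℤ) (r s t : ℚ) : WeierstrassCurve ℚ :=
  (⟨twistFactor E d, r, s, t⟩ : VariableChange ℚ) • (E.baseChange ℚ).quadraticTwist d

theorem baseChange_twistModel (E : WeierstrassCurve ℤ) (d : ℤ) (r s t : ℚ) (K : Type*) [Field K]
    [Algebra ℚ K] : (⟨twistFactor E d, r, s, t⟩ : VariableChange ℚ).baseChange K •
      ((E.baseChange ℚ).quadraticTwist d).baseChange K = (E.twistModel d r s t).baseChange K :=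
  map_variableChange _ _ (algebraMap ℚ K)

end Factor

/-! ### Pullbacks between a curve, its twist, and the minimal models of the twist -/

section TwistPullback

variable (E : WeierstrassCurve ℤ) (d : ℤ) {K : Type*} [Field K] [Algebra ℚ K]

/-- Pullback of differentials from the twist to `E`, over a field containing `√d = δ`. -/
def twistPullback (δ : Kˣ) (hδ : (δ : K) ^ 2 = d) :
    KaehlerDifferential K
      (((E.baseChange ℚ).quadraticTwist d).baseChange K).toAffine.FunctionField →ₗ[K]
      KaehlerDifferential K ((E.baseChange ℚ).baseChange K).toAffine.FunctionField :=
  pullback _ _ ((E.baseChange ℚ).twistChange δ) (twistChange_smul _ d δ hδ)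

/-- Pullback of differentials from the model `[ũ, r, s, t]` of the twist to the twist. -/
def modelPullback (r s t : ℚ) :
    KaehlerDifferential K ((E.twistModel d r s t).baseChange K).toAffine.FunctionField →ₗ[K]
      KaehlerDifferential K
      (((E.baseChange ℚ).quadraticTwist d).baseChange K).toAffine.FunctionField :=
  pullback _ _ ((⟨twistFactor E d, r, s, t⟩ : VariableChange ℚ).baseChange K)
    (E.baseChange_twistModel d r s t K)

end TwistPullback

end WeierstrassCurve

end

/-! Differentials. A transformation `[u,r,s,t]` multiplies `2y + a₁x + a₃` by `u⁻³` and `dx` by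
`u⁻²`, so pulling back multiplies the invariant differential by `u`
(`pullback_invariantDifferential`). The twist has `u = 1/√d` and the model has `u = ũ`; both
formulas follow.

Existence. Over `ℚ` an equation is determined by `(c₄, c₆)` up to `[1,r,s,t]` (`exists_smul_eq`),
and the twist has invariants `(d²c₄, d³c₆)`. What is needed is an integral equation with invariants
`(d²c₄/ũ⁴, d³c₆/ũ⁶)` that is minimal at every prime. By Kraus's criterion, integers `(A, B)` with
congruence conditions at 2 and 3 are the invariants of an integral equation (`exists_of_kraus`), and
these conditions are necessary. Minimality at `p` therefore means that dividing by `(p⁴, p⁶)`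
destroys integrality or Kraus's condition at `p`.

This is a question about one prime at a time: `LocModel` is unaffected by `p`-adic units, and
`ũ/u_p` is such a unit. At each `p`, the minimality of `E` says that `(c₄, c₆)` cannot be divided by
`(p⁴, p⁶)`, and `oddFactor_spec` and `evenFactor_spec` check that `u_p` is the exact power of `p` to
remove after twisting. `exists_of_locModel` then glues the local statements. -/

noncomputable section

namespace WeierstrassCurve

/-! ### Pullback of the invariant differential -/

section PullbackDifferential

variable {F : Type*} [Field F]

theorem kaehlerMap_D {A B : Type*} [CommRing A] [CommRing B] [Algebra F A] [Algebra F B]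
    (φ : A →ₐ[F] B) (a : A) :
    kaehlerMap φ (KaehlerDifferential.D F A a) = KaehlerDifferential.D F B (φ a) := by
  let : Algebra A B := φ.toRingHom.toAlgebra
  have : IsScalarTower F A B := IsScalarTower.of_algebraMap_eq fun a => (φ.commutes a).symm
  exact KaehlerDifferential.map_D F F A B a

theorem kaehlerMap_smul {A B : Type*} [CommRing A] [CommRing B] [Algebra F A] [Algebra F B]
    (φ : A →ₐ[F] B) (a : A) (x : KaehlerDifferential F A) :
    kaehlerMap φ (a • x) = φ a • kaehlerMap φ x := by
  let : Algebra A B := φ.toRingHom.toAlgebra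
  have : IsScalarTower F A B := IsScalarTower.of_algebraMap_eq fun a => (φ.commutes a).symm
  have := (KaehlerDifferential.map F F A B).map_smul a x
  exact this.trans (algebraMap_smul B a _).symm

theorem functionFieldEquiv_algebraMap (W W' : WeierstrassCurve F) (C : VariableChange F)
    (h : C • W = W') (a : W'.toAffine.CoordinateRing) :
    functionFieldEquiv W W' C h (algebraMap _ _ a) = algebraMap _ _ (coordEquiv W W' C h a) := by
  simp [functionFieldEquiv]

theorem coordEquiv_coordX (W W' : WeierstrassCurve F) (C : VariableChange F) (h : C • W = W') :
    coordEquiv W W' C h W'.coordX = algebraMap F W.toAffine.CoordinateRing ((C.u⁻¹ : Fˣ) ^ 2) *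
        (W.coordX - algebraMap F _ C.r) :=
  coordLift_coordX W' (equationIn_new W W' C h)

theorem coordEquiv_coordY (W W' : WeierstrassCurve F) (C : VariableChange F) (h : C • W = W') :
    coordEquiv W W' C h W'.coordY = algebraMap F W.toAffine.CoordinateRing ((C.u⁻¹ : Fˣ) ^ 3) *
        (W.coordY - algebraMap F _ C.s * (W.coordX - algebraMap F _ C.r) -
          algebraMap F _ C.t) :=
  coordLift_coordY W' (equationIn_new W W' C h)

/-- The denominator contributes `u³` and `dx'` contributes `u⁻²`, the translation by `r` being
killed by `D`. -/
theorem pullback_invariantDifferential (W W' : WeierstrassCurve F) (C : VariableChange F)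
    (h : C • W = W') :
    pullback W W' C h W'.invariantDifferential = (C.u : F) • W.invariantDifferential := by
  have hden : coordEquiv W W' C h
      (2 * W'.coordY + algebraMap F _ W'.a₁ * W'.coordX + algebraMap F _ W'.a₃) =
      algebraMap F _ ((C.u⁻¹ : Fˣ) ^ 3) *
        (2 * W.coordY + algebraMap F _ W.a₁ * W.coordX + algebraMap F _ W.a₃) := by
    simp only [map_add, map_mul, AlgEquiv.commutes, coordEquiv_coordX, coordEquiv_coordY,
      map_ofNat]
    subst h
    simp only [variableChange_def, map_mul, map_add, map_pow, map_ofNat]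
    ring
  have hx : algebraMap W.toAffine.CoordinateRing W.toAffine.FunctionField
      (coordEquiv W W' C h W'.coordX) = ((C.u⁻¹ : Fˣ) ^ 2 : F) •
        (algebraMap W.toAffine.CoordinateRing W.toAffine.FunctionField W.coordX -
          algebraMap F _ C.r) := by
    rw [coordEquiv_coordX, map_mul, map_sub,
      ← IsScalarTower.algebraMap_apply F W.toAffine.CoordinateRing W.toAffine.FunctionField,
      ← IsScalarTower.algebraMap_apply F W.toAffine.CoordinateRing W.toAffine.FunctionField,
      ← Algebra.smul_def]
  unfold pullback invariantDifferential
  rw [kaehlerMap_smul, kaehlerMap_D]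
  simp only [AlgEquiv.coe_toAlgHom, map_inv₀, functionFieldEquiv_algebraMap, hden, hx]
  rw [Derivation.map_smul, map_sub, Derivation.map_algebraMap, sub_zero, map_mul,
    ← IsScalarTower.algebraMap_apply F W.toAffine.CoordinateRing W.toAffine.FunctionField,
    mul_inv, ← map_inv₀, mul_comm, mul_smul, algebraMap_smul, smul_smul, smul_comm]
  congr 1
  have := C.u.ne_zero
  simp only [Units.val_inv_eq_inv_val]
  field_simp

end PullbackDifferential

/-! ### Kraus's criterion for integral equations -/

section Kraus

/-- The curve with coefficients `nⁱaᵢ`. -/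
def scale {R : Type*} [CommRing R] (n : R) (W : WeierstrassCurve R) : WeierstrassCurve R :=
  ⟨n * W.a₁, n ^ 2 * W.a₂, n ^ 3 * W.a₃, n ^ 4 * W.a₄, n ^ 6 * W.a₆⟩

theorem scale_c₄ {R : Type*} [CommRing R] (n : R) (W : WeierstrassCurve R) :
    (W.scale n).c₄ = n ^ 4 * W.c₄ := by
  simp only [scale, c₄, b₂, b₄]; ring

theorem scale_c₆ {R : Type*} [CommRing R] (n : R) (W : WeierstrassCurve R) :
    (W.scale n).c₆ = n ^ 6 * W.c₆ := by
  simp only [scale, c₆, b₂, b₄, b₆]; ring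

/-- Kraus's condition at `2` for integers to be the invariants of a `2`-integral equation. -/
def KrausTwo (A B : ℤ) : Prop :=
  64 ∣ A ^ 3 - B ^ 2 ∧ (4 ∣ B + 1 ∨ 16 ∣ A ∧ (32 ∣ B ∨ 32 ∣ B - 8))

/-- Kraus's condition at `3` for integers to be the invariants of a `3`-integral equation. -/
def KrausThree (A B : ℤ) : Prop :=
  27 ∣ A ^ 3 - B ^ 2 ∧ (9 ∣ B → 27 ∣ B)

/-- Kraus's condition at `p` for integers to be the invariants of a `p`-integral equation. -/
def Kraus (p : ℕ) (A B : ℤ) : Prop :=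
  (p = 2 → KrausTwo A B) ∧ (p = 3 → KrausThree A B)

/-- If `a₁` is odd, `c₆ ≡ -b₂³ ≡ -1` modulo 4. If `a₁` is even, then `4 ∣ b₂` and `2 ∣ b₄`, so `16 ∣
c₄` and `c₆ ≡ 8b₆ ≡ 8a₃²` modulo 32. -/
theorem krausTwo_invariants (W : WeierstrassCurve ℤ) : KrausTwo W.c₄ W.c₆ := by
  refine ⟨⟨27 * W.Δ, by linear_combination -W.c_relation⟩, ?_⟩
  obtain ⟨a₁, a₂, a₃, a₄, a₆⟩ := W
  simp only [c₆, c₄, b₂, b₄, b₆]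
  rcases Int.even_or_odd' a₁ with ⟨k, rfl | rfl⟩
  · right
    refine ⟨⟨(k ^ 2 + a₂) ^ 2 - 3 * (a₄ + k * a₃), by ring⟩, ?_⟩
    rcases Int.even_or_odd' a₃ with ⟨l, rfl | rfl⟩
    · left
      exact ⟨-2 * (k ^ 2 + a₂) ^ 3 + 9 * (k ^ 2 + a₂) * (a₄ + 2 * k * l) - 27 * (l ^ 2 + a₆),
        by ring⟩
    · right
      exact ⟨-2 * (k ^ 2 + a₂) ^ 3 + 9 * (k ^ 2 + a₂) * (a₄ + k * (2 * l + 1)) -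
        27 * (l ^ 2 + l + a₆) - 7, by ring⟩
  · left
    set m := k ^ 2 + k + a₂
    have : (2 * k + 1) ^ 2 + 4 * a₂ = 4 * m + 1 := by simp only [m]; ring
    rw [this]
    exact ⟨-(16 * m ^ 3 + 12 * m ^ 2 + 3 * m) + 9 * (4 * m + 1) * (2 * a₄ + (2 * k + 1) * a₃) -
      54 * (a₃ ^ 2 + 4 * a₆), by ring⟩

/-- Modulo 9, `c₆ ≡ -b₂³`; so `9 ∣ c₆` forces `3 ∣ b₂`, and then every term of `c₆` is divisible by
27. -/
theorem krausThree_invariants (W : WeierstrassCurve ℤ) : KrausThree W.c₄ W.c₆ := by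
  refine ⟨⟨64 * W.Δ, by linear_combination -W.c_relation⟩, ?_⟩
  simp only [c₆]
  intro h
  have h3 : (3 : ℤ) ∣ W.b₂ ^ 3 := by
    obtain ⟨k, hk⟩ := h
    exact ⟨-3 * k + 12 * W.b₂ * W.b₄ - 72 * W.b₆, by linear_combination -hk⟩
  obtain ⟨k, hk⟩ := Int.prime_three.dvd_of_dvd_pow h3
  rw [hk]
  exact ⟨-k ^ 3 + 4 * k * W.b₄ - 8 * W.b₆, by ring⟩

theorem kraus_invariants (p : ℕ) (W : WeierstrassCurve ℤ) : Kraus p W.c₄ W.c₆ :=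
  ⟨fun _ => krausTwo_invariants W, fun _ => krausThree_invariants W⟩

/-- These are the 3-parts of the divisibilities needed to solve for `b₄` and `b₆` once `b₂ = -B`. -/
theorem KrausThree.dvd {A B : ℤ} (h : KrausThree A B) :
    3 ∣ B ^ 2 - A ∧ 27 ∣ -B ^ 3 + 3 * A * B - 2 * B := by
  obtain ⟨⟨k, hk⟩, hB⟩ := h
  by_cases h3 : (3 : ℤ) ∣ B
  · have hA : (3 : ℤ) ∣ A := by
      apply Int.prime_three.dvd_of_dvd_pow (n := 3)
      obtain ⟨b, rfl⟩ := h3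
      exact ⟨3 * b ^ 2 + 9 * k, by linear_combination hk⟩
    obtain ⟨a, rfl⟩ := hA
    obtain ⟨b, rfl⟩ := h3
    have h9 : (9 : ℤ) ∣ 3 * b := by
      have : (3 : ℤ) ∣ b ^ 2 := ⟨a ^ 3 - k, by linarith⟩
      have := Int.prime_three.dvd_of_dvd_pow this
      omega
    obtain ⟨c, hc⟩ := hB h9
    have : b = 9 * c := by omega
    subst this
    exact ⟨⟨243 * c ^ 2 - a, by ring⟩, ⟨-729 * c ^ 3 + 9 * a * c - 2 * c, by ring⟩⟩
  · have h1 : B % 3 = 1 ∨ B % 3 = 2 := by omega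
    have hB2 : (3 : ℤ) ∣ B ^ 2 - 1 := by
      rcases h1 with h1 | h1
      · obtain ⟨b, hb⟩ : ∃ b, B = 3 * b + 1 := ⟨B / 3, by omega⟩
        exact ⟨3 * b ^ 2 + 2 * b, by rw [hb]; ring⟩
      · obtain ⟨b, hb⟩ : ∃ b, B = 3 * b + 2 := ⟨B / 3, by omega⟩
        exact ⟨3 * b ^ 2 + 4 * b + 1, by rw [hb]; ring⟩
    have hA3 : (3 : ℤ) ∣ A ^ 3 - 1 := by
      obtain ⟨q, hq⟩ := hB2
      exact ⟨q + 9 * k, by linear_combination hk + hq⟩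
    have hA : (3 : ℤ) ∣ A - 1 := by
      have : (3 : ℤ) ∣ (A - 1) ^ 3 := by
        obtain ⟨q, hq⟩ := hA3
        exact ⟨q - A ^ 2 + A, by linear_combination hq⟩
      exact Int.prime_three.dvd_of_dvd_pow this
    obtain ⟨q, hq⟩ := hB2
    obtain ⟨a, ha⟩ := hA
    have ha : A = 3 * a + 1 := by omega
    subst ha
    refine ⟨⟨q - a, by linear_combination hq⟩, ?_⟩
    have h9 : (9 : ℤ) ∣ 3 * q := ⟨3 * a ^ 3 + 3 * a ^ 2 + a - 3 * k, by
      linear_combination -hq - hk⟩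
    obtain ⟨r, hr⟩ : (3 : ℤ) ∣ q := by omega
    have hra : (3 : ℤ) ∣ r - a := ⟨a ^ 3 + a ^ 2 - k, by linarith⟩
    obtain ⟨s, hs⟩ := hra
    exact ⟨-s * B, by linear_combination (-B) * hq - 3 * B * hr - 9 * B * hs⟩

/-- Sufficiency of Kraus's conditions: an explicit equation over `ℤ`. -/
theorem exists_of_kraus {A B : ℤ} (h2 : KrausTwo A B) (h3 : KrausThree A B) :
    ∃ W : WeierstrassCurve ℤ, W.c₄ = A ∧ W.c₆ = B := by
  obtain ⟨h31, h32⟩ := h3.dvd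
  obtain ⟨⟨e, he⟩, h2⟩ := h2
  -- Always `c₆ ≡ -b₂³ ≡ -b₂` modulo 12, and a shift of `x` by `r` adds `12r` to `b₂`, so `b₂ = -B`
  -- is no restriction. Then `c₄ = A` and `c₆ = B` fix `24b₄` and `432b₆`.
  suffices H : ∃ a₁ a₂ a₃ a₄ a₆ : ℤ, a₁ ^ 2 + 4 * a₂ = -B ∧
      24 * (2 * a₄ + a₁ * a₃) = B ^ 2 - A ∧
      432 * (a₃ ^ 2 + 4 * a₆) = -B ^ 3 + 3 * A * B - 2 * B by
    obtain ⟨a₁, a₂, a₃, a₄, a₆, h1, h2, h3⟩ := H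
    refine ⟨⟨a₁, a₂, a₃, a₄, a₆⟩, ?_, ?_⟩
    · simp only [c₄, b₂, b₄, h1]
      linear_combination -h2
    · simp only [c₆, b₂, b₄, b₆, h1]
      linarith [congrArg (B * ·) h2]
  rcases h2 with ⟨b, hb⟩ | ⟨⟨a, rfl⟩, hB⟩
  · -- odd case
    obtain rfl : B = 4 * b - 1 := by omega
    have hA8 : (8 : ℤ) ∣ A - 1 := by
      have hAo : A % 2 = 1 := by
        rcases Int.even_or_odd' A with ⟨k, rfl | rfl⟩
        · exfalso
          have : (2 : ℤ) ∣ 1 := ⟨4 * k ^ 3 - 8 * b ^ 2 + 4 * b - 32 * e, by linarith⟩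
          omega
        · omega
      obtain ⟨k, rfl⟩ : ∃ k, A = 2 * k + 1 := ⟨A / 2, by omega⟩
      obtain ⟨m, hm⟩ : ∃ m, k * (k + 1) = 2 * m := (Int.even_mul_succ_self k).two_dvd
      exact ⟨8 * e + 2 * b ^ 2 - b - m * (2 * k + 1), by
        linear_combination he - 4 * (2 * k + 1) * hm⟩
    obtain ⟨a, ha⟩ := hA8
    obtain rfl : A = 8 * a + 1 := by omega
    obtain ⟨c, hc⟩ : (24 : ℤ) ∣ (4 * b - 1) ^ 2 - (8 * a + 1) := by
      have : (8 : ℤ) ∣ (4 * b - 1) ^ 2 - (8 * a + 1) := ⟨2 * b ^ 2 - b - a, by ring⟩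
      omega
    have hc2 : (2 : ℤ) ∣ c := by
      have : (2 : ℤ) ∣ 3 * c := ⟨32 * a ^ 3 + 12 * a ^ 2 + a - 4 * e, by linarith⟩
      omega
    obtain ⟨c, rfl⟩ := hc2
    -- As `B² = A + 48c`, the value required of `432b₆` is `16B(a - 3c)`; with `a₃ = 0` it must be
    -- divisible by 64.
    obtain ⟨t, ht⟩ : (4 : ℤ) ∣ a - 3 * c := ⟨e - 8 * a ^ 3 - 3 * a ^ 2, by linarith⟩
    have hf : -(4 * b - 1) ^ 3 + 3 * (8 * a + 1) * (4 * b - 1) - 2 * (4 * b - 1) =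
        64 * ((4 * b - 1) * t) := by
      linear_combination -(4 * b - 1) * hc + 16 * (4 * b - 1) * ht
    rw [hf] at h32 ⊢
    obtain ⟨g, hg⟩ : (27 : ℤ) ∣ (4 * b - 1) * t := by
      generalize (4 * b - 1) * t = z at h32
      omega
    exact ⟨1, -b, 0, c, g, by ring, by linarith, by linarith⟩
  · -- even case
    obtain ⟨β, rfl⟩ : (8 : ℤ) ∣ B := by omega
    have hf : -(8 * β) ^ 3 + 3 * (16 * a) * (8 * β) - 2 * (8 * β) =
        16 * (β * (8 * (3 * a - 4 * β ^ 2) - 1)) := by ring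
    have hd : (8 * β) ^ 2 - 16 * a = 16 * (4 * β ^ 2 - a) := by ring
    rw [hf] at h32 ⊢
    rw [hd] at h31 ⊢
    obtain ⟨c, hc⟩ : (3 : ℤ) ∣ 4 * β ^ 2 - a := by omega
    have h27 : (27 : ℤ) ∣ β * (8 * (3 * a - 4 * β ^ 2) - 1) := by omega
    rw [hc]
    -- Here `27b₆ = β(8(3a - 4β²) - 1)`, so `b₆ ≡ β` modulo 4; hence `a₃ = 0` or `a₃ = 1` according
    -- to `B` modulo 32.
    rcases hB with hB | hB
    · obtain ⟨γ, rfl⟩ : (4 : ℤ) ∣ β := by omega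
      obtain ⟨g, hg⟩ : (27 * 4 : ℤ) ∣ 4 * γ * (8 * (3 * a - 4 * (4 * γ) ^ 2) - 1) := by
        have : (4 : ℤ) ∣ 4 * γ * (8 * (3 * a - 4 * (4 * γ) ^ 2) - 1) :=
          ⟨γ * (8 * (3 * a - 4 * (4 * γ) ^ 2) - 1), by ring⟩
        omega
      exact ⟨0, -(8 * γ), 0, c, g, by ring, by ring, by linarith⟩
    · obtain ⟨γ, hγ⟩ : (4 : ℤ) ∣ β - 1 := by omega
      obtain ⟨g, hg⟩ : (27 * 4 : ℤ) ∣ β * (8 * (3 * a - 4 * β ^ 2) - 1) - 27 := by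
        have : (4 : ℤ) ∣ β * (8 * (3 * a - 4 * β ^ 2) - 1) - 27 :=
          ⟨β * 2 * (3 * a - 4 * β ^ 2) - γ - 7, by linarith⟩
        omega
      exact ⟨0, -(2 * β), 1, c, g, by ring, by ring, by linarith⟩

end Kraus

/-! ### Kraus's condition at 2 for twists -/

section TwistAtTwo

theorem krausTwo_of_even {A B : ℤ} (hA : 16 ∣ A) (hB : 32 ∣ B ∨ 32 ∣ B - 8) : KrausTwo A B := by
  refine ⟨?_, Or.inr ⟨hA, hB⟩⟩
  obtain ⟨a, rfl⟩ := hA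
  obtain ⟨b, rfl⟩ : (8 : ℤ) ∣ B := by omega
  exact ⟨64 * a ^ 3 - b ^ 2, by ring⟩

theorem KrausTwo.odd_of_odd {A B : ℤ} (h : KrausTwo A B) (hB : B % 2 = 1) : A % 2 = 1 := by
  obtain ⟨⟨e, he⟩, -⟩ := h
  obtain ⟨b, rfl⟩ : ∃ b, B = 2 * b + 1 := ⟨B / 2, by omega⟩
  rcases Int.even_or_odd' A with ⟨k, rfl | rfl⟩
  · exfalso
    have : (2 : ℤ) ∣ 1 := ⟨4 * k ^ 3 - 2 * b ^ 2 - 2 * b - 32 * e, by linarith⟩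
    omega
  · omega

theorem dvd_mul_iff_of_isCoprime {R : Type*} [CommSemiring R] {k m n : R} (h : IsCoprime k m) :
    k ∣ m * n ↔ k ∣ n :=
  ⟨h.dvd_of_dvd_mul_left, fun h => h.mul_left m⟩

/-- Since `y ≡ 1` modulo 4, multiplication by `y` preserves the class of `B` modulo 4, and modulo 32
when `8 ∣ B`. -/
theorem krausTwo_mul_iff {A B x y : ℤ} (hx : x % 2 = 1) (hy : y % 4 = 1) (hxy : x ^ 3 = y ^ 2) :
    KrausTwo (x * A) (y * B) ↔ KrausTwo A B := by
  have hx2 : IsCoprime (2 : ℤ) x := by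
    rw [Int.prime_two.coprime_iff_not_dvd]; omega
  have hy2 : IsCoprime (2 : ℤ) y := by
    rw [Int.prime_two.coprime_iff_not_dvd]; omega
  have e1 : (64 : ℤ) ∣ (x * A) ^ 3 - (y * B) ^ 2 ↔ 64 ∣ A ^ 3 - B ^ 2 := by
    have : (x * A) ^ 3 - (y * B) ^ 2 = x ^ 3 * (A ^ 3 - B ^ 2) := by
      linear_combination B ^ 2 * hxy
    rw [this]
    exact dvd_mul_iff_of_isCoprime (hx2.pow (m := 6) (n := 3))
  have e2 : (16 : ℤ) ∣ x * A ↔ 16 ∣ A := dvd_mul_iff_of_isCoprime (hx2.pow_left (m := 4))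
  have e3 : (32 : ℤ) ∣ y * B ↔ 32 ∣ B := dvd_mul_iff_of_isCoprime (hy2.pow_left (m := 5))
  have e4 : (8 : ℤ) ∣ y * B ↔ 8 ∣ B := dvd_mul_iff_of_isCoprime (hy2.pow_left (m := 3))
  obtain ⟨q, hq⟩ : ∃ q, y = 4 * q + 1 := ⟨y / 4, by omega⟩
  have hyB : y * B = 4 * (q * B) + B := by rw [hq]; ring
  have e5 : (4 : ℤ) ∣ y * B + 1 ↔ 4 ∣ B + 1 := by rw [hyB]; omega
  have e6 : (32 : ℤ) ∣ y * B - 8 ↔ 32 ∣ B - 8 := by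
    by_cases h8 : (8 : ℤ) ∣ B
    · obtain ⟨b, rfl⟩ := h8
      have : y * (8 * b) = 32 * (q * b) + 8 * b := by rw [hq]; ring
      rw [this]; omega
    · have h8' := mt e4.1 h8
      constructor <;> intro h <;> omega
  rw [KrausTwo, KrausTwo, e1, e2, e3, e5, e6]

/-- The pair obtained from `(A, B)` by dividing by `(p⁴ʲ, p⁶ʲ)` satisfies Kraus's condition. -/
def KrausDiv (p j : ℕ) (A B : ℤ) : Prop :=
  ∃ a b : ℤ, A = p ^ (4 * j) * a ∧ B = p ^ (6 * j) * b ∧ Kraus p a b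

theorem kraus_two_iff {A B : ℤ} : Kraus 2 A B ↔ KrausTwo A B := by simp [Kraus]

theorem krausDiv_zero_iff {p : ℕ} {A B : ℤ} : KrausDiv p 0 A B ↔ Kraus p A B := by
  simp [KrausDiv]

theorem krausDiv_two_mul_iff {A B x y : ℤ} (hx : x % 2 = 1) (hy : y % 4 = 1)
    (hxy : x ^ 3 = y ^ 2) (j : ℕ) :
    KrausDiv 2 j (x * A) (y * B) ↔ KrausDiv 2 j A B := by
  have hx2 : IsCoprime (2 : ℤ) x := by
    rw [Int.prime_two.coprime_iff_not_dvd]; omega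
  have hy2 : IsCoprime (2 : ℤ) y := by
    rw [Int.prime_two.coprime_iff_not_dvd]; omega
  simp only [KrausDiv, kraus_two_iff, Nat.cast_ofNat]
  constructor
  · rintro ⟨a, b, ha, hb, h⟩
    obtain ⟨a', rfl⟩ : (2 : ℤ) ^ (4 * j) ∣ A := hx2.pow_left.dvd_of_dvd_mul_left ⟨a, ha⟩
    obtain ⟨b', rfl⟩ : (2 : ℤ) ^ (6 * j) ∣ B := hy2.pow_left.dvd_of_dvd_mul_left ⟨b, hb⟩
    refine ⟨a', b', rfl, rfl, ?_⟩
    rw [mul_left_comm] at ha hb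
    rw [← mul_left_cancel₀ (by positivity) ha, ← mul_left_cancel₀ (by positivity) hb] at h
    exact (krausTwo_mul_iff hx hy hxy).1 h
  · rintro ⟨a, b, rfl, rfl, h⟩
    exact ⟨x * a, y * b, by ring, by ring, (krausTwo_mul_iff hx hy hxy).2 h⟩

/-- At 2 an odd twist acts only through the sign `s ≡ w` modulo 4, because `sw ≡ 1` modulo 4. -/
theorem krausDiv_two_twist_iff {A B w s : ℤ} (hs : s = 1 ∨ s = -1) (hw : 4 ∣ w - s) (j : ℕ) :
    KrausDiv 2 j (w ^ 2 * A) (w ^ 3 * B) ↔ KrausDiv 2 j A (s * B) := by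
  have hw' : (s * w) % 4 = 1 := by rcases hs with rfl | rfl <;> omega
  have hs2 : s ^ 2 = 1 := by rcases hs with rfl | rfl <;> rfl
  have e1 : w ^ 2 * A = (s * w) ^ 2 * A := by rw [mul_pow, hs2, one_mul]
  have e2 : w ^ 3 * B = (s * w) ^ 3 * (s * B) := by
    linear_combination -(s ^ 2 + 1) * w ^ 3 * B * hs2
  rw [e1, e2]
  have hm : s * w ≡ 1 [ZMOD 4] := hw'
  apply krausDiv_two_mul_iff _ _ (by ring)
  · have := hm.pow 2
    simp only [Int.ModEq] at this
    omega
  · have := hm.pow 3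
    simpa [Int.ModEq] using this

variable {A B D : ℤ}

/-- Changing the sign of `B` destroys both `B ≡ -1` modulo 4 and `B ≡ 8` modulo 32; multiplying by
`(2⁴, 2⁶)` repairs this. -/
theorem twist_neg_half (h : KrausTwo A B)
    (hAB : (¬ 2 ∣ A ∧ ¬ 2 ∣ B) ∨ 16 ∣ A ∧ 8 ∣ B ∧ ¬ 16 ∣ B) :
    KrausTwo (16 * A) (64 * -B) ∧ ¬ KrausTwo A (-B) := by
  obtain ⟨-, h⟩ := h
  refine ⟨krausTwo_of_even (by omega) (by omega), fun h' => ?_⟩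
  obtain ⟨-, h'⟩ := h'
  omega

theorem twist_neg_two (hD : A ^ 3 - B ^ 2 = 1728 * D)
    (hAB : (16 ∣ A ∧ 64 ∣ B ∧ 4096 ∣ D ∧ (B / 64) % 4 = 1) ∨
      256 ∣ A ∧ 512 ∣ B ∧ (B / 512) % 4 = 3) :
    KrausDiv 2 1 A (-B) ∧ ¬ KrausDiv 2 2 A (-B) := by
  constructor
  · rcases hAB with ⟨⟨a, rfl⟩, ⟨b, rfl⟩, ⟨e, rfl⟩, h⟩ | ⟨⟨a, rfl⟩, ⟨b, rfl⟩, h⟩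
    · refine ⟨a, -b, by norm_num, by norm_num, kraus_two_iff.2 ⟨?_, by omega⟩⟩
      have : a ^ 3 - b ^ 2 = 64 * (27 * e) := by linarith
      exact ⟨27 * e, by linarith⟩
    · exact ⟨16 * a, -(8 * b), by norm_num; ring, by norm_num; ring,
        kraus_two_iff.2 (krausTwo_of_even (by omega) (by omega))⟩
  · rintro ⟨a, b, ha, hb, -⟩
    norm_num at ha hb
    omega

/-- If `(A, -B)` could be divided by `(2⁴, 2⁶)`, the quotient `(a, b)` would satisfy one of three
cases of Kraus: `b` odd and `b ≡ 8` modulo 32 are the signatures excluded by `h2`, while `32 ∣ b` is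
insensitive to sign and contradicts `hmin`. -/
theorem twist_neg_one (h : KrausTwo A B) (hD : A ^ 3 - B ^ 2 = 1728 * D)
    (hmin : ¬ KrausDiv 2 1 A B)
    (h1 : ¬ ((¬ 2 ∣ A ∧ ¬ 2 ∣ B) ∨ 16 ∣ A ∧ (8 ∣ B ∧ ¬ 16 ∣ B) ∧ ¬ 2 ∣ D))
    (h2 : ¬ (((16 ∣ A ∧ ¬ 32 ∣ A) ∧ (64 ∣ B ∧ ¬ 128 ∣ B) ∧ 4096 ∣ D ∧ (B / 64) % 4 = 1) ∨
      256 ∣ A ∧ (512 ∣ B ∧ ¬ 1024 ∣ B) ∧ (4096 ∣ D ∧ ¬ 8192 ∣ D) ∧ (B / 512) % 4 = 3)) :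
    KrausTwo A (-B) ∧ ¬ KrausDiv 2 1 A (-B) := by
  have hodd : B % 2 = 0 := by
    by_contra hB
    have := h.odd_of_odd (by omega)
    omega
  obtain ⟨hA, hB⟩ : 16 ∣ A ∧ (32 ∣ B ∨ 32 ∣ B - 8) := by
    rcases h.2 with h | h
    · omega
    · exact h
  have hB : 32 ∣ B := by
    rcases hB with hB | hB
    · exact hB
    -- `B ≡ 8` modulo 32 makes `D` odd, which is a signature excluded by `h1`.
    · have : ¬ 2 ∣ D := by
        obtain ⟨a, rfl⟩ := hA
        obtain ⟨b, hb⟩ := hB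
        obtain rfl : B = 8 * (4 * b + 1) := by omega
        have : 27 * D = 2 * (32 * a ^ 3 - 8 * b ^ 2 - 4 * b) - 1 := by linarith
        omega
      omega
  refine ⟨krausTwo_of_even hA (by omega), ?_⟩
  rintro ⟨a, b, ha, hb, hab⟩
  norm_num at ha hb
  rw [kraus_two_iff] at hab
  rcases hab.2 with h4 | ⟨ha16, hb | hb⟩
  · have hao := hab.odd_of_odd (by omega)
    obtain ⟨⟨e, he⟩, -⟩ := hab
    have : 27 * D = 4096 * e := by
      obtain rfl : B = -(64 * b) := by omega
      subst ha
      linarith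
    omega
  · exact hmin ⟨a, -b, by norm_num [ha], by norm_num; omega,
      kraus_two_iff.2 (krausTwo_of_even ha16 (by omega))⟩
  · obtain ⟨a, rfl⟩ := ha16
    obtain ⟨b, hb⟩ := hb
    obtain rfl : B = -(512 * (4 * b + 1)) := by omega
    subst ha
    have : 27 * D = 4096 * (2 * (32 * a ^ 3 - 8 * b ^ 2 - 4 * b) - 1) := by linarith
    omega

theorem twist_two_half {s : ℤ} (hA : ¬ 2 ∣ A) :
    KrausTwo (16 * (4 * A)) (64 * (s * (8 * B))) ∧ ¬ KrausTwo (4 * A) (s * (8 * B)) := by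
  constructor
  · exact krausTwo_of_even (by omega) (Or.inl ⟨16 * s * B, by ring⟩)
  · rintro ⟨-, ⟨k, h⟩ | h⟩
    · have : (2 : ℤ) ∣ 1 := ⟨2 * k - 4 * s * B, by linarith⟩
      omega
    · omega

theorem twist_two_four {s : ℤ} (hs : s = 1 ∨ s = -1) (hD : A ^ 3 - B ^ 2 = 1728 * D)
    (hA : 64 ∣ A) (hB : 512 ∣ B) (hD' : 2 ^ 18 ∣ D) (hB' : (s * (B / 512)) % 4 = 3) :
    KrausDiv 2 2 (4 * A) (s * (8 * B)) ∧ ¬ KrausDiv 2 3 (4 * A) (s * (8 * B)) := by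
  constructor
  · obtain ⟨a, rfl⟩ := hA
    obtain ⟨b, rfl⟩ := hB
    obtain ⟨e, rfl⟩ := hD'
    rw [Int.mul_ediv_cancel_left _ (by norm_num)] at hB'
    refine ⟨a, s * b, by norm_num; ring, by norm_num; ring, kraus_two_iff.2 ⟨⟨27 * e, ?_⟩, ?_⟩⟩
    · have hs2 : s ^ 2 = 1 := by rcases hs with rfl | rfl <;> rfl
      rw [mul_pow, hs2]
      linarith
    · left; omega
  · rintro ⟨a, b, ha, hb, -⟩
    norm_num at ha hb
    rcases hs with rfl | rfl <;> omega

/-- Dividing by `(2⁴, 2⁶)` leaves `(A/4, sB/8)` with `A/4` even, so Kraus would require `64 ∣ A` and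
`sB ≡ 0` or `64` modulo 256. Each alternative of `h1` violates this. -/
theorem twist_two_one {s : ℤ} (hs : s = 1 ∨ s = -1) (h : KrausTwo A B)
    (h1 : (16 ∣ A ∧ ¬ 64 ∣ A) ∨
      ((8 ∣ B ∧ ¬ 16 ∣ B) ∨ (32 ∣ B ∧ ¬ 64 ∣ B) ∨ (128 ∣ B ∧ ¬ 256 ∣ B)) ∨
      ((64 ∣ B ∧ ¬ 128 ∣ B) ∧ (s * (B / 64)) % 4 = 3)) :
    KrausTwo (4 * A) (s * (8 * B)) ∧ ¬ KrausDiv 2 1 (4 * A) (s * (8 * B)) := by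
  have hodd : B % 2 = 0 := by
    by_contra hB
    have := h.odd_of_odd (by omega)
    omega
  obtain ⟨hA, hB⟩ : 16 ∣ A ∧ (32 ∣ B ∨ 32 ∣ B - 8) := by
    rcases h.2 with h | h
    · omega
    · exact h
  constructor
  · apply krausTwo_of_even (by omega)
    rcases hs with rfl | rfl <;> omega
  · rintro ⟨a, b, ha, hb, hab⟩
    norm_num at ha hb
    rw [kraus_two_iff] at hab
    have := fun h => hab.odd_of_odd h
    replace hab := hab.2
    rcases hs with rfl | rfl <;> omega

/-- Excluding `h1` and `h3` forces `A = 64a`, `B = 64b` with `sb ≡ 0` or `1` modulo 4, which permits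
one division. A second division leads either to the signature in `h2` or, in the even case, back to
a division of `(A, B)` itself. -/
theorem twist_two_two {s : ℤ} (hs : s = 1 ∨ s = -1) (h : KrausTwo A B)
    (hD : A ^ 3 - B ^ 2 = 1728 * D) (hmin : ¬ KrausDiv 2 1 A B)
    (h1 : ¬ (¬ 2 ∣ A ∧ ¬ 2 ∣ B))
    (h2 : ¬ ((64 ∣ A ∧ ¬ 128 ∣ A) ∧ (512 ∣ B ∧ ¬ 1024 ∣ B) ∧ 2 ^ 18 ∣ D ∧
      (s * (B / 512)) % 4 = 3))
    (h3 : ¬ ((16 ∣ A ∧ ¬ 64 ∣ A) ∨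
      ((8 ∣ B ∧ ¬ 16 ∣ B) ∨ (32 ∣ B ∧ ¬ 64 ∣ B) ∨ (128 ∣ B ∧ ¬ 256 ∣ B)) ∨
      (64 ∣ A ∧ (64 ∣ B ∧ ¬ 128 ∣ B) ∧ (64 ∣ D ∧ ¬ 128 ∣ D) ∧ (s * (B / 64)) % 4 = 3))) :
    KrausDiv 2 1 (4 * A) (s * (8 * B)) ∧ ¬ KrausDiv 2 2 (4 * A) (s * (8 * B)) := by
  have hodd : B % 2 = 0 := by
    by_contra hB
    have := h.odd_of_odd (by omega)
    omega
  obtain ⟨hA, hB⟩ : 16 ∣ A ∧ (32 ∣ B ∨ 32 ∣ B - 8) := by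
    rcases h.2 with h | h
    · omega
    · exact h
  obtain ⟨a, rfl⟩ : 64 ∣ A := by omega
  obtain ⟨b, rfl⟩ : 64 ∣ B := by omega
  constructor
  · refine ⟨16 * a, s * (8 * b), by norm_num; ring, by norm_num; ring,
      kraus_two_iff.2 (krausTwo_of_even (by omega) ?_)⟩
    by_cases hb : 2 ∣ b
    · rcases hs with rfl | rfl <;> omega
    · have : (64 ∣ D ∧ ¬ 128 ∣ D) := by
        obtain ⟨c, rfl⟩ : ∃ c, b = 2 * c + 1 := ⟨b / 2, by omega⟩
        have : 27 * D = 64 * (2 * (32 * a ^ 3 - 2 * c ^ 2 - 2 * c) - 1) := by linarith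
        omega
      rcases hs with rfl | rfl <;> omega
  · rintro ⟨x, y, ha, hb, hab⟩
    norm_num at ha hb
    rw [kraus_two_iff] at hab
    obtain rfl : a = x := by omega
    obtain ⟨z, rfl⟩ : 8 ∣ b := by rcases hs with rfl | rfl <;> omega
    obtain rfl : y = s * z := by rcases hs with rfl | rfl <;> omega
    rcases hab.2 with h4 | ⟨ha16, hb⟩
    · have hao := hab.odd_of_odd (by omega)
      obtain ⟨⟨e, he⟩, -⟩ := hab
      have hs2 : s ^ 2 = 1 := by rcases hs with rfl | rfl <;> rfl
      rw [mul_pow, hs2] at he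
      have : 27 * D = 2 ^ 18 * e := by linarith
      rcases hs with rfl | rfl <;> omega
    · refine hmin ⟨4 * a, 8 * z, by norm_num; ring, by norm_num,
        kraus_two_iff.2 (krausTwo_of_even (by omega) ?_)⟩
      rcases hs with rfl | rfl <;> omega

end TwistAtTwo

/-! ### Kraus's condition at odd primes for twists -/

section TwistAtOdd

theorem krausThree_mul_iff {A B x y : ℤ} (hx : ¬ 3 ∣ x) (hy : ¬ 3 ∣ y) (hxy : x ^ 3 = y ^ 2) :
    KrausThree (x * A) (y * B) ↔ KrausThree A B := by
  have hx3 : IsCoprime (3 : ℤ) x := Int.prime_three.coprime_iff_not_dvd.2 hx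
  have hy3 : IsCoprime (3 : ℤ) y := Int.prime_three.coprime_iff_not_dvd.2 hy
  have e1 : (27 : ℤ) ∣ (x * A) ^ 3 - (y * B) ^ 2 ↔ 27 ∣ A ^ 3 - B ^ 2 := by
    have : (x * A) ^ 3 - (y * B) ^ 2 = x ^ 3 * (A ^ 3 - B ^ 2) := by
      linear_combination B ^ 2 * hxy
    rw [this]
    exact dvd_mul_iff_of_isCoprime (hx3.pow (m := 3) (n := 3))
  have e2 : (9 : ℤ) ∣ y * B ↔ 9 ∣ B := dvd_mul_iff_of_isCoprime (hy3.pow_left (m := 2))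
  have e3 : (27 : ℤ) ∣ y * B ↔ 27 ∣ B := dvd_mul_iff_of_isCoprime (hy3.pow_left (m := 3))
  rw [KrausThree, KrausThree, e1, e2, e3]

theorem kraus_iff_of_ne_two {p : ℕ} (hp2 : p ≠ 2) {A B : ℤ} :
    Kraus p A B ↔ (p = 3 → KrausThree A B) := by simp [Kraus, hp2]

theorem kraus_mul_iff_of_ne_two {p : ℕ} (hp2 : p ≠ 2) {A B x y : ℤ}
    (hx : ¬ (p : ℤ) ∣ x) (hy : ¬ (p : ℤ) ∣ y) (hxy : x ^ 3 = y ^ 2) :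
    Kraus p (x * A) (y * B) ↔ Kraus p A B := by
  simp only [kraus_iff_of_ne_two hp2]
  refine forall_congr' fun h => ?_
  subst h
  exact krausThree_mul_iff hx hy hxy

theorem krausDiv_mul_iff_of_ne_two {p : ℕ} (hp : p.Prime) (hp2 : p ≠ 2) {A B x y : ℤ}
    (hx : ¬ (p : ℤ) ∣ x) (hy : ¬ (p : ℤ) ∣ y) (hxy : x ^ 3 = y ^ 2) (j : ℕ) :
    KrausDiv p j (x * A) (y * B) ↔ KrausDiv p j A B := by
  have hp' := Nat.prime_iff_prime_int.1 hp
  have hp0 : (p : ℤ) ≠ 0 := hp'.ne_zero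
  have hx2 : IsCoprime (p : ℤ) x := hp'.coprime_iff_not_dvd.2 hx
  have hy2 : IsCoprime (p : ℤ) y := hp'.coprime_iff_not_dvd.2 hy
  constructor
  · rintro ⟨a, b, ha, hb, h⟩
    obtain ⟨a', rfl⟩ : (p : ℤ) ^ (4 * j) ∣ A := hx2.pow_left.dvd_of_dvd_mul_left ⟨a, ha⟩
    obtain ⟨b', rfl⟩ : (p : ℤ) ^ (6 * j) ∣ B := hy2.pow_left.dvd_of_dvd_mul_left ⟨b, hb⟩
    refine ⟨a', b', rfl, rfl, ?_⟩
    rw [mul_left_comm] at ha hb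
    rw [← mul_left_cancel₀ (pow_ne_zero _ hp0) ha, ← mul_left_cancel₀ (pow_ne_zero _ hp0) hb] at h
    exact (kraus_mul_iff_of_ne_two hp2 hx hy hxy).1 h
  · rintro ⟨a, b, rfl, rfl, h⟩
    exact ⟨x * a, y * b, by ring, by ring, (kraus_mul_iff_of_ne_two hp2 hx hy hxy).2 h⟩

variable {p : ℕ} {A B D : ℤ}

/-- Division by `(p⁴, p⁶)` leaves `(A/p², B/p³)`. For `p = 3` and `v₃(B) = 5` the second entry has
valuation exactly 2, which Kraus forbids. -/
theorem twist_prime_one (hp : p.Prime) (hp2 : p ≠ 2) (hD : A ^ 3 - B ^ 2 = 1728 * D)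
    (h : ¬ ((p : ℤ) ^ 2 ∣ A ∧ (p : ℤ) ^ 3 ∣ B ∧ (p : ℤ) ^ 6 ∣ D) ∨
      p = 3 ∧ (p : ℤ) ^ 5 ∣ B ∧ ¬ (p : ℤ) ^ 6 ∣ B) :
    Kraus p (p ^ 2 * A) (p ^ 3 * B) ∧ ¬ KrausDiv p 1 (p ^ 2 * A) (p ^ 3 * B) := by
  have hp' := Nat.prime_iff_prime_int.1 hp
  constructor
  · rw [kraus_iff_of_ne_two hp2]
    rintro rfl
    exact ⟨⟨27 * (A ^ 3 - B ^ 2), by push_cast; ring⟩, fun _ => ⟨B, by norm_num⟩⟩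
  · rintro ⟨a, b, ha, hb, hab⟩
    rw [kraus_iff_of_ne_two hp2] at hab
    obtain rfl : A = p ^ 2 * a :=
      mul_left_cancel₀ (pow_ne_zero 2 hp'.ne_zero) (ha.trans (by ring))
    obtain rfl : B = p ^ 3 * b :=
      mul_left_cancel₀ (pow_ne_zero 3 hp'.ne_zero) (hb.trans (by ring))
    have hD' : (p : ℤ) ^ 6 * (a ^ 3 - b ^ 2) = 1728 * D := by rw [← hD]; ring
    rcases h with h | ⟨rfl, h5, h6⟩
    · refine h ⟨Dvd.intro _ rfl, Dvd.intro _ rfl, ?_⟩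
      by_cases hp3 : p = 3
      · subst hp3
        -- The factor 27 from Kraus's condition cancels the 27 in 1728.
        obtain ⟨⟨e, he⟩, -⟩ := hab rfl
        rw [he] at hD'
        norm_num at hD' ⊢
        omega
      · have hc : IsCoprime (p : ℤ) 1728 := by
          rw [show (1728 : ℤ) = ((2 ^ 6 * 3 ^ 3 : ℕ) : ℤ) by norm_num, Nat.isCoprime_iff_coprime]
          exact Nat.Coprime.mul_right
            (((Nat.coprime_primes hp Nat.prime_two).2 hp2).pow_right _)
            (((Nat.coprime_primes hp Nat.prime_three).2 hp3).pow_right _)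
        exact hc.pow_left.dvd_of_dvd_mul_left ⟨_, hD'.symm⟩
    · have := (hab rfl).2
      norm_num at h5 h6
      omega

theorem twist_prime_self (hp : p.Prime) (hp2 : p ≠ 2) (hD : A ^ 3 - B ^ 2 = 1728 * D)
    (hmin : ¬ KrausDiv p 1 A B)
    (h : (p : ℤ) ^ 2 ∣ A ∧ (p : ℤ) ^ 3 ∣ B ∧ (p : ℤ) ^ 6 ∣ D)
    (h5 : ¬ (p = 3 ∧ (p : ℤ) ^ 5 ∣ B ∧ ¬ (p : ℤ) ^ 6 ∣ B)) :
    KrausDiv p 1 (p ^ 2 * A) (p ^ 3 * B) ∧ ¬ KrausDiv p 2 (p ^ 2 * A) (p ^ 3 * B) := by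
  have hp' := Nat.prime_iff_prime_int.1 hp
  constructor
  · obtain ⟨⟨a, rfl⟩, ⟨b, rfl⟩, ⟨e, rfl⟩⟩ := h
    refine ⟨a, b, by ring, by ring, (kraus_iff_of_ne_two hp2).2 ?_⟩
    rintro rfl
    norm_num at hD h5
    refine ⟨⟨64 * e, by linarith⟩, by omega⟩
  · rintro ⟨a, b, ha, hb, -⟩
    obtain rfl : A = p ^ 6 * a :=
      mul_left_cancel₀ (pow_ne_zero 2 hp'.ne_zero) (ha.trans (by ring))
    obtain rfl : B = p ^ 9 * b :=
      mul_left_cancel₀ (pow_ne_zero 3 hp'.ne_zero) (hb.trans (by ring))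
    -- Two divisions give `p⁶ ∣ A` and `p⁹ ∣ B`, so `(A, B)` can itself be divided; the spare `(p²,
    -- p³)` makes Kraus at 3 automatic.
    refine hmin ⟨p ^ 2 * a, p ^ 3 * b, by ring, by ring, (kraus_iff_of_ne_two hp2).2 ?_⟩
    rintro rfl
    exact ⟨⟨27 * (a ^ 3 - b ^ 2), by push_cast; ring⟩, fun _ => ⟨b, by norm_num⟩⟩

end TwistAtOdd

/-! ### Local models and gluing over all primes -/

section LocalModels

/-- The rational numbers `A`, `B` are the invariants `c₄`, `c₆` of a `p`-integral equation: a
multiple `(m⁴A, m⁶B)` with `m` prime to `p` comes from an equation over `ℤ`. -/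
def LocModel (p : ℕ) (A B : ℚ) : Prop :=
  ∃ (W : WeierstrassCurve ℤ) (m : ℤ), ¬ (p : ℤ) ∣ m ∧ (W.c₄ : ℚ) = m ^ 4 * A ∧
    (W.c₆ : ℚ) = m ^ 6 * B

variable {p : ℕ}

theorem LocModel.mul (hp : p.Prime) {A B : ℚ} (h : LocModel p A B) {x : ℚ} (hx : ¬ p ∣ x.den) :
    LocModel p (x ^ 4 * A) (x ^ 6 * B) := by
  obtain ⟨W, m, hm, h4, h6⟩ := h
  have hx0 : (x.den : ℚ) ≠ 0 := by exact_mod_cast x.den_ne_zero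
  have hx' : (x.num : ℚ) = x.den * x := by rw [mul_comm]; exact (Rat.mul_den_eq_num x).symm
  refine ⟨W.scale x.num, m * x.den, ?_, ?_, ?_⟩
  · rw [(Nat.prime_iff_prime_int.1 hp).dvd_mul]
    rintro (h | h)
    · exact hm h
    · exact hx (Int.natCast_dvd_natCast.1 h)
  · rw [scale_c₄]; push_cast; rw [h4, hx']; ring
  · rw [scale_c₆]; push_cast; rw [h6, hx']; ring

theorem KrausTwo.of_mul {A B m : ℤ} (hm : ¬ 2 ∣ m) (h : KrausTwo (m ^ 4 * A) (m ^ 6 * B)) :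
    KrausTwo A B := by
  refine (krausTwo_mul_iff ?_ ?_ (by ring)).1 h
  · have : m ≡ 1 [ZMOD 2] := by simp only [Int.ModEq]; omega
    exact this.pow 4
  · have : m ^ 2 ≡ 1 [ZMOD 4] := by
      obtain ⟨k, rfl⟩ : ∃ k, m = 2 * k + 1 := ⟨m / 2, by omega⟩
      exact (Int.modEq_iff_dvd.2 ⟨-k ^ 2 - k, by ring⟩)
    have := this.pow 3
    rwa [← pow_mul] at this

theorem Kraus.of_mul (hp : p.Prime) {A B m : ℤ} (hm : ¬ (p : ℤ) ∣ m)
    (h : Kraus p (m ^ 4 * A) (m ^ 6 * B)) : Kraus p A B := by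
  refine ⟨?_, ?_⟩
  · rintro rfl
    exact (h.1 rfl).of_mul hm
  · rintro rfl
    exact (krausThree_mul_iff (fun h => hm (Int.prime_three.dvd_of_dvd_pow h))
      (fun h => hm (Int.prime_three.dvd_of_dvd_pow h)) (by ring)).1 (h.2 rfl)

theorem LocModel.krausDiv (hp : p.Prime) {A B : ℤ} {j : ℕ}
    (h : LocModel p (A / (p ^ j) ^ 4) (B / (p ^ j) ^ 6)) : KrausDiv p j A B := by
  obtain ⟨W, m, hm, h4, h6⟩ := h
  have hp' := Nat.prime_iff_prime_int.1 hp
  have hp0 : (p : ℚ) ≠ 0 := by exact_mod_cast hp.ne_zero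
  have hc : IsCoprime (p : ℤ) m := hp'.coprime_iff_not_dvd.2 hm
  have e4 : m ^ 4 * A = p ^ (4 * j) * W.c₄ := by
    field_simp at h4
    exact_mod_cast (show (m ^ 4 * A : ℚ) = p ^ (4 * j) * W.c₄ by rw [← h4]; ring)
  have e6 : m ^ 6 * B = p ^ (6 * j) * W.c₆ := by
    field_simp at h6
    exact_mod_cast (show (m ^ 6 * B : ℚ) = p ^ (6 * j) * W.c₆ by rw [← h6]; ring)
  obtain ⟨a, rfl⟩ : (p : ℤ) ^ (4 * j) ∣ A := hc.pow.dvd_of_dvd_mul_left ⟨_, e4⟩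
  obtain ⟨b, rfl⟩ : (p : ℤ) ^ (6 * j) ∣ B := hc.pow.dvd_of_dvd_mul_left ⟨_, e6⟩
  refine ⟨a, b, rfl, rfl, ?_⟩
  rw [mul_left_comm] at e4 e6
  have := kraus_invariants p W
  rw [← mul_left_cancel₀ (pow_ne_zero _ hp'.ne_zero) e4,
    ← mul_left_cancel₀ (pow_ne_zero _ hp'.ne_zero) e6] at this
  exact this.of_mul hp hm

theorem Kraus.locModel (hp : p.Prime) {A B : ℤ} (h : Kraus p A B) : LocModel p A B := by
  -- Scaling by an `m` prime to `p` but divisible by the other primes among 2 and 3 makes Kraus's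
  -- conditions there automatic: `m` is 3, 2 or 6.
  suffices H : ∃ m : ℤ, ¬ (p : ℤ) ∣ m ∧ KrausTwo (m ^ 4 * A) (m ^ 6 * B) ∧
      KrausThree (m ^ 4 * A) (m ^ 6 * B) by
    obtain ⟨m, hm, h2, h3⟩ := H
    obtain ⟨W, h4, h6⟩ := exists_of_kraus h2 h3
    exact ⟨W, m, hm, by rw [h4]; push_cast; rfl, by rw [h6]; push_cast; rfl⟩
  have hK3 : ∀ k : ℤ, KrausThree ((3 * k) ^ 4 * A) ((3 * k) ^ 6 * B) := fun k =>
    ⟨⟨3 ^ 9 * (k ^ 12 * (A ^ 3 - B ^ 2)), by ring⟩, fun _ => ⟨27 * k ^ 6 * B, by ring⟩⟩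
  have hK2 : ∀ k : ℤ, KrausTwo ((2 * k) ^ 4 * A) ((2 * k) ^ 6 * B) := fun k =>
    krausTwo_of_even ⟨k ^ 4 * A, by ring⟩ (Or.inl ⟨2 * k ^ 6 * B, by ring⟩)
  by_cases hp2 : p = 2
  · subst hp2
    exact ⟨3 * 1, by norm_num, (krausTwo_mul_iff (by norm_num) (by norm_num) (by norm_num)).2
      (h.1 rfl), hK3 1⟩
  by_cases hp3 : p = 3
  · subst hp3
    exact ⟨2 * 1, by norm_num, hK2 1, (krausThree_mul_iff (by norm_num) (by norm_num)
      (by norm_num)).2 (h.2 rfl)⟩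
  refine ⟨2 * 3, ?_, hK2 3, ?_⟩
  · rw [(Nat.prime_iff_prime_int.1 hp).dvd_mul]
    rintro (h | h)
    · exact hp2 ((Nat.prime_dvd_prime_iff_eq hp Nat.prime_two).1 (by exact_mod_cast h))
    · exact hp3 ((Nat.prime_dvd_prime_iff_eq hp Nat.prime_three).1 (by exact_mod_cast h))
  · exact hK3 2

theorem locModel_iff_krausDiv (hp : p.Prime) {A B : ℤ} {j : ℕ} :
    LocModel p (A / (p ^ j) ^ 4) (B / (p ^ j) ^ 6) ↔ KrausDiv p j A B := by
  refine ⟨LocModel.krausDiv hp, ?_⟩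
  rintro ⟨a, b, rfl, rfl, h⟩
  have hp0 : (p : ℚ) ≠ 0 := by exact_mod_cast hp.ne_zero
  convert h.locModel hp using 1
  · push_cast; field_simp; ring
  · push_cast; field_simp; ring

theorem locModel_iff_kraus (hp : p.Prime) {A B : ℤ} : LocModel p A B ↔ Kraus p A B := by
  simpa [krausDiv_zero_iff] using locModel_iff_krausDiv hp (A := A) (B := B) (j := 0)

/-- Local models at all primes give an equation over `ℤ`. -/
theorem exists_of_locModel {A B : ℚ} (h : ∀ p : ℕ, p.Prime → LocModel p A B) :
    ∃ W : WeierstrassCurve ℤ, (W.c₄ : ℚ) = A ∧ (W.c₆ : ℚ) = B := by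
  have key : ∀ (x : ℚ) (k : ℕ), (∀ p : ℕ, p.Prime → ∃ n m : ℤ, ¬ (p : ℤ) ∣ m ∧
      (n : ℚ) = m ^ k * x) → ∃ n : ℤ, (n : ℚ) = x := by
    intro x k hx
    refine ⟨x.num, Rat.coe_int_num_of_den_eq_one ?_⟩
    by_contra hden
    obtain ⟨p, hp, hpd⟩ := Nat.exists_prime_and_dvd hden
    obtain ⟨n, m, hm, hn⟩ := hx p hp
    have hp' := Nat.prime_iff_prime_int.1 hp
    have e : n * x.den = m ^ k * x.num := by
      have : (n * x.den : ℚ) = m ^ k * x.num := by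
        rw [hn, mul_assoc, Rat.mul_den_eq_num]
      exact_mod_cast this
    have hd : (p : ℤ) ∣ m ^ k * x.num :=
      e ▸ (Int.natCast_dvd_natCast.2 hpd).mul_left n
    rcases hp'.dvd_or_dvd hd with h | h
    · exact hm (hp'.dvd_of_dvd_pow h)
    · have := Nat.dvd_gcd (Int.natCast_dvd.1 h) hpd
      rw [x.reduced.gcd_eq_one] at this
      exact hp.one_lt.ne' (Nat.dvd_one.1 this)
  obtain ⟨A, rfl⟩ := key A 4 fun p hp => by
    obtain ⟨W, m, hm, h4, -⟩ := h p hp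
    exact ⟨_, m, hm, h4⟩
  obtain ⟨B, rfl⟩ := key B 6 fun p hp => by
    obtain ⟨W, m, hm, -, h6⟩ := h p hp
    exact ⟨_, m, hm, h6⟩
  obtain ⟨W, h4, h6⟩ := exists_of_kraus
    (((locModel_iff_kraus Nat.prime_two).1 (h 2 Nat.prime_two)).1 rfl)
    (((locModel_iff_kraus Nat.prime_three).1 (h 3 Nat.prime_three)).2 rfl)
  exact ⟨W, by rw [h4], by rw [h6]⟩

end LocalModels

/-! ### Minimality in terms of local models -/

section Minimality

/-- Over `ℚ`, equations whose invariants differ by `u⁴`, `u⁶` are related by a transformation with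
this `u`. -/
theorem exists_smul_eq {W W' : WeierstrassCurve ℚ} (u : ℚˣ) (h4 : (u : ℚ) ^ 4 * W'.c₄ = W.c₄)
    (h6 : (u : ℚ) ^ 6 * W'.c₆ = W.c₆) :
    ∃ r s t : ℚ, (⟨u, r, s, t⟩ : VariableChange ℚ) • W = W' := by
  have hu : (u : ℚ) ≠ 0 := u.ne_zero
  obtain ⟨a₁, a₂, a₃, a₄, a₆⟩ := W
  obtain ⟨a₁', a₂', a₃', a₄', a₆'⟩ := W'
  -- `s`, `r`, `t` match `a₁`, `a₂`, `a₃` in turn; then `c₄` determines `a₄` and `c₆` determines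
  -- `a₆`.
  obtain ⟨s, hs⟩ : ∃ s, a₁ + 2 * s = u * a₁' := ⟨(u * a₁' - a₁) / 2, by ring⟩
  obtain ⟨r, hr⟩ : ∃ r, a₂ - s * a₁ + 3 * r - s ^ 2 = u ^ 2 * a₂' :=
    ⟨(u ^ 2 * a₂' - a₂ + s * a₁ + s ^ 2) / 3, by ring⟩
  obtain ⟨t, ht⟩ : ∃ t, a₃ + r * a₁ + 2 * t = u ^ 3 * a₃' :=
    ⟨(u ^ 3 * a₃' - a₃ - r * a₁) / 2, by ring⟩
  set V : WeierstrassCurve ℚ := (⟨1, r, s, t⟩ : VariableChange ℚ) • ⟨a₁, a₂, a₃, a₄, a₆⟩ with hV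
  have v4 : V.c₄ = (u : ℚ) ^ 4 * c₄ ⟨a₁', a₂', a₃', a₄', a₆'⟩ := by
    rw [hV, variableChange_c₄, h4]; simp
  have v6 : V.c₆ = (u : ℚ) ^ 6 * c₆ ⟨a₁', a₂', a₃', a₄', a₆'⟩ := by
    rw [hV, variableChange_c₆, h6]; simp
  have v1 : V.a₁ = u * a₁' := by rw [← hs]; simp [hV, variableChange_def]
  have v2 : V.a₂ = u ^ 2 * a₂' := by rw [← hr]; simp [hV, variableChange_def]
  have v3 : V.a₃ = u ^ 3 * a₃' := by rw [← ht]; simp [hV, variableChange_def]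
  simp only [c₄, c₆, b₂, b₄, b₆, v1, v2, v3] at v4 v6
  have v4' : V.a₄ = u ^ 4 * a₄' := by linear_combination -v4 / 48
  rw [v4'] at v6
  have v6' : V.a₆ = u ^ 6 * a₆' := by linear_combination -v6 / 864
  simp only [hV, variableChange_def, inv_one, Units.val_one, one_pow, one_mul] at v1 v2 v3 v4' v6'
  refine ⟨r, s, t, ?_⟩
  ext <;> simp only [variableChange_def, Units.val_inv_eq_inv_val]
  · rw [v1]; field_simp
  · rw [v2]; field_simp
  · rw [v3]; field_simp
  · rw [v4']; field_simp
  · rw [v6']; field_simp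

theorem IsIntegralAt.locModel {p : ℕ} (hp : p.Prime) {W : WeierstrassCurve ℚ}
    (h : W.IsIntegralAt p) : LocModel p W.c₄ W.c₆ := by
  obtain ⟨h1, h2, h3, h4, h6⟩ := h
  have key : ∀ x : ℚ, ∀ e : ℤ, ∃ n : ℤ, (n : ℚ) = (x.den * e : ℤ) * x := fun x e =>
    ⟨e * x.num, by push_cast; rw [← Rat.mul_den_eq_num x]; ring⟩
  set m : ℤ := W.a₁.den * W.a₂.den * W.a₃.den * W.a₄.den * W.a₆.den with hm
  obtain ⟨n1, e1⟩ := key W.a₁ (W.a₂.den * W.a₃.den * W.a₄.den * W.a₆.den)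
  obtain ⟨n2, e2⟩ := key W.a₂ (W.a₁.den * W.a₃.den * W.a₄.den * W.a₆.den * m)
  obtain ⟨n3, e3⟩ := key W.a₃ (W.a₁.den * W.a₂.den * W.a₄.den * W.a₆.den * m ^ 2)
  obtain ⟨n4, e4⟩ := key W.a₄ (W.a₁.den * W.a₂.den * W.a₃.den * W.a₆.den * m ^ 3)
  obtain ⟨n6, e6⟩ := key W.a₆ (W.a₁.den * W.a₂.den * W.a₃.den * W.a₄.den * m ^ 5)
  have f1 : (n1 : ℚ) = m * W.a₁ := by rw [e1, hm]; push_cast; ring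
  have f2 : (n2 : ℚ) = m ^ 2 * W.a₂ := by rw [e2, hm]; push_cast; ring
  have f3 : (n3 : ℚ) = m ^ 3 * W.a₃ := by rw [e3, hm]; push_cast; ring
  have f4 : (n4 : ℚ) = m ^ 4 * W.a₄ := by rw [e4, hm]; push_cast; ring
  have f6 : (n6 : ℚ) = m ^ 6 * W.a₆ := by rw [e6, hm]; push_cast; ring
  refine ⟨⟨n1, n2, n3, n4, n6⟩, m, ?_, ?_, ?_⟩
  · rw [hm]
    exact_mod_cast hp.not_dvd_mul (hp.not_dvd_mul (hp.not_dvd_mul (hp.not_dvd_mul h1 h2) h3) h4) h6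
  · rw [← scale_c₄]
    simp only [c₄, b₂, b₄, scale, ← f1, ← f2, ← f3, ← f4]
    push_cast; rfl
  · rw [← scale_c₆]
    simp only [c₆, b₂, b₄, b₆, scale, ← f1, ← f2, ← f3, ← f4, ← f6]
    push_cast; rfl

theorem not_dvd_den_of_padicValRat_nonneg {p : ℕ} (hp : p.Prime) {x : ℚ}
    (h : 0 ≤ padicValRat p x) : ¬ p ∣ x.den := by
  have := Fact.mk hp
  intro hd
  have h1 := one_le_padicValNat_of_dvd x.den_ne_zero hd
  have h2 : padicValInt p x.num = 0 := by
    apply padicValInt.eq_zero_of_not_dvd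
    intro hn
    have := Nat.dvd_gcd (Int.natCast_dvd.1 hn) hd
    rw [x.reduced.gcd_eq_one] at this
    exact hp.one_lt.ne' (Nat.dvd_one.1 this)
  rw [padicValRat_def, h2] at h
  omega

theorem baseChange_c₄' (W : WeierstrassCurve ℤ) : (W.baseChange ℚ).c₄ = (W.c₄ : ℚ) := by
  simp [baseChange]

theorem baseChange_c₆' (W : WeierstrassCurve ℤ) : (W.baseChange ℚ).c₆ = (W.c₆ : ℚ) := by
  simp [baseChange]

theorem isIntegralAt_baseChange (W : WeierstrassCurve ℤ) {p : ℕ} (hp : p.Prime) :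
    (W.baseChange ℚ).IsIntegralAt p := by
  simp [IsIntegralAt, baseChange, hp.one_lt.ne']

/-- Such a model would come from a transformation with `u = p/m`, lowering the valuation of `Δ` by
12. -/
theorem IsGlobalMinimal.not_locModel {E : WeierstrassCurve ℤ}
    (hE : (E.baseChange ℚ).IsGlobalMinimal) {p : ℕ} (hp : p.Prime) :
    ¬ LocModel p (E.c₄ / p ^ 4) (E.c₆ / p ^ 6) := by
  rintro ⟨W, m, hm, h4, h6⟩
  have := Fact.mk hp
  have hp0 : (p : ℚ) ≠ 0 := by exact_mod_cast hp.ne_zero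
  have hm0 : (m : ℚ) ≠ 0 := by
    rintro h
    rw [Int.cast_eq_zero] at h
    exact hm (h ▸ dvd_zero _)
  obtain ⟨r, s, t, hC⟩ := exists_smul_eq (W := E.baseChange ℚ) (W' := W.baseChange ℚ)
    (Units.mk0 (p / m : ℚ) (div_ne_zero hp0 hm0))
    (by rw [baseChange_c₄', baseChange_c₄', h4, Units.val_mk0]; field_simp)
    (by rw [baseChange_c₆', baseChange_c₆', h6, Units.val_mk0]; field_simp)
  have hmin := hE.minimal p hp _ (hC ▸ isIntegralAt_baseChange W hp)
  have hΔ : (E.baseChange ℚ).Δ ≠ 0 := hE.isElliptic.isUnit.ne_zero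
  rw [variableChange_Δ, padicValRat.mul (pow_ne_zero _ (Units.ne_zero _)) hΔ, padicValRat.pow,
    Units.val_inv_eq_inv_val, padicValRat.inv, Units.val_mk0, padicValRat.div hp0 hm0,
    padicValRat.self hp.one_lt, padicValRat.of_int, padicValInt.eq_zero_of_not_dvd hm] at hmin
  norm_num at hmin

/-- A transformation lowering `v_p(Δ)` has `p ∣ u`, so `u/p` is `p`-integral; scaling its result by
`u/p` gives a local model with invariants `(c₄/p⁴, c₆/p⁶)`. -/
theorem isGlobalMinimal_of_not_locModel {W : WeierstrassCurve ℤ} (hΔ : (W.baseChange ℚ).Δ ≠ 0)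
    (h : ∀ p : ℕ, p.Prime → ¬ LocModel p (W.c₄ / p ^ 4) (W.c₆ / p ^ 6)) :
    (W.baseChange ℚ).IsGlobalMinimal := by
  refine ⟨⟨isUnit_iff_ne_zero.2 hΔ⟩, ⟨W, rfl⟩, fun p hp C hC => ?_⟩
  have := Fact.mk hp
  by_contra! hlt
  have hp0 : (p : ℚ) ≠ 0 := by exact_mod_cast hp.ne_zero
  have hu0 : (C.u : ℚ) ≠ 0 := C.u.ne_zero
  rw [variableChange_Δ, padicValRat.mul (pow_ne_zero _ (Units.ne_zero _)) hΔ, padicValRat.pow,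
    Units.val_inv_eq_inv_val, padicValRat.inv] at hlt
  push_cast at hlt
  have hx : 0 ≤ padicValRat p (C.u / p : ℚ) := by
    rw [padicValRat.div hu0 hp0, padicValRat.self hp.one_lt]
    omega
  apply h p hp
  have := (hC.locModel hp).mul hp (not_dvd_den_of_padicValRat_nonneg hp hx)
  rw [variableChange_c₄, variableChange_c₆, baseChange_c₄', baseChange_c₆',
    Units.val_inv_eq_inv_val] at this
  convert this using 1 <;> field_simp

end Minimality

/-! ### The local factors and the minimal model of the twist -/

section LocalFactor

/-- Signature conditions become divisibilities by explicit powers, within reach of `omega`. -/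
theorem pval_eq_ofNat_iff {p k : ℕ} [k.AtLeastTwo] {n : ℤ} :
    pval p n = ofNat(k) ↔ (p : ℤ) ^ k ∣ n ∧ ¬ (p : ℤ) ^ (k + 1) ∣ n :=
  emultiplicity_eq_coe

theorem ofNat_le_pval_iff {p k : ℕ} [k.AtLeastTwo] {n : ℤ} :
    ofNat(k) ≤ pval p n ↔ (p : ℤ) ^ k ∣ n :=
  pow_dvd_iff_le_emultiplicity.symm

theorem pval_eq_zero_iff {p : ℕ} {n : ℤ} : pval p n = 0 ↔ ¬ (p : ℤ) ∣ n :=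
  emultiplicity_eq_zero

theorem mul_modEq_four_iff {z w s r : ℤ} (h : 4 ∣ w - s) :
    z * w ≡ r [ZMOD 4] ↔ (s * z) % 4 = r % 4 := by
  have : z * w ≡ s * z [ZMOD 4] := by
    rw [mul_comm s]
    exact ((Int.modEq_iff_dvd.2 h).symm).mul_left z
  exact ⟨fun h' => this.symm.trans h', fun h' => this.trans h'⟩

theorem not_min_lt_six_iff {p : ℕ} {A B D : ℤ} :
    ¬ min (3 * pval p A) (min (2 * pval p B) (pval p D)) < 6 ↔
      (p : ℤ) ^ 2 ∣ A ∧ (p : ℤ) ^ 3 ∣ B ∧ (p : ℤ) ^ 6 ∣ D := by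
  have h3 : ∀ x : ℕ∞, 6 ≤ 3 * x ↔ 2 ≤ x := fun x => by
    induction x using ENat.recTopCoe with
    | top => simp [ENat.mul_top]
    | coe n => norm_cast; omega
  have h2 : ∀ x : ℕ∞, 6 ≤ 2 * x ↔ 3 ≤ x := fun x => by
    induction x using ENat.recTopCoe with
    | top => simp [ENat.mul_top]
    | coe n => norm_cast; omega
  rw [not_lt, le_min_iff, le_min_iff, h3, h2, ofNat_le_pval_iff, ofNat_le_pval_iff,
    ofNat_le_pval_iff]

variable {E : WeierstrassCurve ℤ} {d : ℤ}

theorem c_relation' (E : WeierstrassCurve ℤ) : E.c₄ ^ 3 - E.c₆ ^ 2 = 1728 * E.Δ :=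
  E.c_relation.symm

theorem oddFactor_spec {p : ℕ} (hp : p.Prime) (hp2 : p ≠ 2)
    (hmin : ¬ KrausDiv p 1 E.c₄ E.c₆) (hd : Squarefree d) :
    ∃ j : ℕ, oddFactor E d p = (p : ℚ) ^ j ∧ KrausDiv p j (d ^ 2 * E.c₄) (d ^ 3 * E.c₆) ∧
      ¬ KrausDiv p (j + 1) (d ^ 2 * E.c₄) (d ^ 3 * E.c₆) := by
  have hp' := Nat.prime_iff_prime_int.1 hp
  have hD := c_relation' E
  by_cases hpd : (p : ℤ) ∣ d
  · obtain ⟨w, rfl⟩ := hpd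
    have hw : ¬ (p : ℤ) ∣ w := by
      rintro ⟨v, rfl⟩
      exact hp'.not_isUnit (hd p ⟨v, by ring⟩)
    have key : ∀ j, KrausDiv p j ((p * w) ^ 2 * E.c₄) ((p * w) ^ 3 * E.c₆) ↔
        KrausDiv p j (p ^ 2 * E.c₄) (p ^ 3 * E.c₆) := fun j => by
      rw [show (p * w) ^ 2 * E.c₄ = w ^ 2 * (p ^ 2 * E.c₄) by ring,
        show (p * w) ^ 3 * E.c₆ = w ^ 3 * (p ^ 3 * E.c₆) by ring]
      exact krausDiv_mul_iff_of_ne_two hp hp2 (fun h => hw (hp'.dvd_of_dvd_pow h))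
        (fun h => hw (hp'.dvd_of_dvd_pow h)) (by ring) j
    have h5 : (p = 3 ∧ pval p E.c₆ = 5) ↔
        (p = 3 ∧ (p : ℤ) ^ 5 ∣ E.c₆ ∧ ¬ (p : ℤ) ^ 6 ∣ E.c₆) := by
      rw [pval_eq_ofNat_iff]
    simp only [key]
    by_cases hc : min (3 * pval p E.c₄) (min (2 * pval p E.c₆) (pval p E.Δ)) < 6 ∨
        (p = 3 ∧ pval p E.c₆ = 5)
    · refine ⟨0, by simp only [oddFactor, dvd_mul_right, if_true, if_pos hc, pow_zero], ?_⟩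
      rw [krausDiv_zero_iff]
      rw [← not_not (a := _ < _), not_min_lt_six_iff, h5] at hc
      exact twist_prime_one hp hp2 hD hc
    · refine ⟨1, by simp only [oddFactor, dvd_mul_right, if_true, hc, if_false, pow_one], ?_⟩
      rw [not_or, not_min_lt_six_iff, h5] at hc
      exact twist_prime_self hp hp2 hD hmin hc.1 hc.2
  · refine ⟨0, by simp [oddFactor, hpd], ?_⟩
    simp only [krausDiv_mul_iff_of_ne_two hp hp2 (fun h => hpd (hp'.dvd_of_dvd_pow h))
        (fun h => hpd (hp'.dvd_of_dvd_pow h)) (show (d ^ 2) ^ 3 = (d ^ 3) ^ 2 by ring)]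
    exact ⟨krausDiv_zero_iff.2 (kraus_invariants p E), hmin⟩

/-- `KrausDiv` takes natural exponents, so the value `1/2` is expressed by multiplying the
invariants by `(2⁴, 2⁶)`. The twist reduces to `(A, B)`, `(A, -B)` or `(4A, 8sB)` for `d` congruent
to 1, 3 or 2 modulo 4. -/
theorem evenFactor_spec (hmin : ¬ KrausDiv 2 1 E.c₄ E.c₆) (hd : Squarefree d) :
    (∃ j : ℕ, evenFactor E d = 2 ^ j ∧ KrausDiv 2 j (d ^ 2 * E.c₄) (d ^ 3 * E.c₆) ∧
      ¬ KrausDiv 2 (j + 1) (d ^ 2 * E.c₄) (d ^ 3 * E.c₆)) ∨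
    evenFactor E d = 1 / 2 ∧
      KrausDiv 2 0 (d ^ 2 * (16 * E.c₄)) (d ^ 3 * (64 * E.c₆)) ∧
      ¬ KrausDiv 2 0 (d ^ 2 * E.c₄) (d ^ 3 * E.c₆) := by
  have hD := c_relation' E
  have hK := krausTwo_invariants E
  have h4 : ¬ 4 ∣ d := by
    rintro ⟨v, rfl⟩
    have := Int.isUnit_iff.1 (hd 2 ⟨v, by ring⟩)
    omega
  generalize hu : evenFactor E d = u
  simp only [evenFactor, pval_eq_ofNat_iff, ofNat_le_pval_iff, pval_eq_zero_iff] at hu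
  norm_num only [Nat.cast_ofNat] at hu
  generalize E.c₄ = A at *
  generalize E.c₆ = B at *
  generalize E.Δ = D at *
  by_cases h1 : d ≡ 1 [ZMOD 4]
  · rw [if_pos h1] at hu
    replace h1 : d % 4 = 1 := h1
    left
    have key := fun j => krausDiv_two_twist_iff (A := A) (B := B) (s := 1) (Or.inl rfl)
      (show 4 ∣ d - 1 by omega) j
    simp only [one_mul] at key
    refine ⟨0, by rw [← hu, pow_zero], ?_⟩
    rw [key, key, krausDiv_zero_iff, kraus_two_iff]
    exact ⟨hK, hmin⟩
  rw [if_neg h1] at hu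
  replace h1 : ¬ d % 4 = 1 := h1
  by_cases h3 : d ≡ 3 [ZMOD 4]
  · rw [if_pos h3] at hu
    replace h3 : d % 4 = 3 := h3
    have hd1 : 4 ∣ d - -1 := by omega
    have key := fun A B j => krausDiv_two_twist_iff (A := A) (B := B) (Or.inr rfl) hd1 j
    simp only [neg_one_mul] at key
    simp only [key]
    simp only [mul_modEq_four_iff hd1] at hu
    split_ifs at hu with c1 c2
    · right
      refine ⟨hu.symm, ?_⟩
      rw [krausDiv_zero_iff, krausDiv_zero_iff, kraus_two_iff, kraus_two_iff, ← mul_neg]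
      exact twist_neg_half hK (by omega)
    · left
      refine ⟨1, by rw [← hu, pow_one], twist_neg_two hD (by omega)⟩
    · left
      refine ⟨0, by rw [← hu, pow_zero], ?_⟩
      rw [krausDiv_zero_iff, kraus_two_iff]
      exact twist_neg_one hK hD hmin (by omega) (by omega)
  · rw [if_neg h3] at hu
    replace h3 : ¬ d % 4 = 3 := h3
    obtain ⟨w, rfl⟩ : ∃ w, d = 2 * w := ⟨d / 2, by omega⟩
    rw [Int.mul_ediv_cancel_left _ (by norm_num)] at hu
    obtain ⟨s, hs, hws⟩ : ∃ s : ℤ, (s = 1 ∨ s = -1) ∧ 4 ∣ w - s := by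
      rcases (by omega : w % 4 = 1 ∨ w % 4 = 3) with h | h
      · exact ⟨1, Or.inl rfl, by omega⟩
      · exact ⟨-1, Or.inr rfl, by omega⟩
    have key : ∀ A B j, KrausDiv 2 j ((2 * w) ^ 2 * A) ((2 * w) ^ 3 * B) ↔
        KrausDiv 2 j (4 * A) (s * (8 * B)) := fun A B j => by
      rw [← krausDiv_two_twist_iff hs hws]
      ring_nf
    simp only [key]
    simp only [mul_modEq_four_iff hws] at hu
    split_ifs at hu with c1 c2 c3
    · right
      refine ⟨hu.symm, ?_⟩
      rw [krausDiv_zero_iff, krausDiv_zero_iff, kraus_two_iff, kraus_two_iff,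
        mul_left_comm 4 16, mul_left_comm 8 64, mul_left_comm s 64]
      exact twist_two_half (by omega)
    · left
      refine ⟨2, by rw [← hu]; norm_num, twist_two_four hs hD (by omega) (by omega) (by omega)
        (by omega)⟩
    · left
      refine ⟨0, by rw [← hu, pow_zero], ?_⟩
      rw [krausDiv_zero_iff, kraus_two_iff]
      exact twist_two_one hs hK (by omega)
    · left
      refine ⟨1, by rw [← hu, pow_one], twist_two_two hs hK hD hmin c1 (by omega) (by omega)⟩

/-- The local factor makes the invariants of the twist minimal at `p`. -/
theorem localFactor_spec {p : ℕ} (hp : p.Prime) (hE : (E.baseChange ℚ).IsGlobalMinimal)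
    (hd : Squarefree d) :
    (LocModel p (d ^ 2 * E.c₄ / localFactor E d p ^ 4) (d ^ 3 * E.c₆ / localFactor E d p ^ 6) ∧
      ¬ LocModel p (d ^ 2 * E.c₄ / localFactor E d p ^ 4 / p ^ 4)
        (d ^ 3 * E.c₆ / localFactor E d p ^ 6 / p ^ 6)) ∧
      ∃ k : ℤ, localFactor E d p = (p : ℚ) ^ k := by
  have hmin : ¬ KrausDiv p 1 E.c₄ E.c₆ := by
    rw [← locModel_iff_krausDiv hp, pow_one]
    exact hE.not_locModel hp
  have of_pow : (∃ j : ℕ, localFactor E d p = (p : ℚ) ^ j ∧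
      KrausDiv p j (d ^ 2 * E.c₄) (d ^ 3 * E.c₆) ∧
      ¬ KrausDiv p (j + 1) (d ^ 2 * E.c₄) (d ^ 3 * E.c₆)) →
    (LocModel p (d ^ 2 * E.c₄ / localFactor E d p ^ 4) (d ^ 3 * E.c₆ / localFactor E d p ^ 6) ∧
      ¬ LocModel p (d ^ 2 * E.c₄ / localFactor E d p ^ 4 / p ^ 4)
        (d ^ 3 * E.c₆ / localFactor E d p ^ 6 / p ^ 6)) ∧
      ∃ k : ℤ, localFactor E d p = (p : ℚ) ^ k := by
    rintro ⟨j, hj, h⟩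
    rw [← locModel_iff_krausDiv hp, ← locModel_iff_krausDiv hp] at h
    refine ⟨?_, j, by rw [hj, zpow_natCast]⟩
    rw [hj, div_div, div_div, ← mul_pow, ← mul_pow, ← pow_succ]
    push_cast at h
    exact h
  by_cases hp2 : p = 2
  · subst hp2
    have hl : localFactor E d 2 = evenFactor E d := by simp [localFactor]
    rcases evenFactor_spec hmin hd with h | ⟨hu, h1, h2⟩
    · exact of_pow (by rw [hl]; exact_mod_cast h)
    · refine ⟨?_, -1, by rw [hl, hu]; norm_num⟩
      rw [krausDiv_zero_iff, ← locModel_iff_kraus hp] at h1 h2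
      rw [hl, hu]
      push_cast at h1 h2
      refine ⟨?_, fun h => h2 ?_⟩
      · convert h1 using 1 <;> ring
      · convert h using 1 <;> norm_num <;> ring
  · have hl : localFactor E d p = oddFactor E d p := by simp [localFactor, hp2]
    exact of_pow (by rw [hl]; exact oddFactor_spec hp hp2 hmin hd)

theorem localFactor_of_notMem {p : ℕ} (hp : p.Prime) (hd : d ≠ 0)
    (h : p ∉ (2 * d).natAbs.primeFactors) : localFactor E d p = 1 := by
  rw [Nat.mem_primeFactors_of_ne_zero (by simpa using hd)] at h
  simp only [hp, true_and, ← Int.natCast_dvd] at h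
  have h2 : p ≠ 2 := by
    rintro rfl
    exact h (Dvd.intro _ rfl)
  have hpd : ¬ (p : ℤ) ∣ d := fun h' => h (h'.mul_left 2)
  simp [localFactor, h2, oddFactor, hpd]

/-- Every `u_q` with `q ≠ p` is a power of `q`, hence a `p`-adic unit. -/
theorem padicValRat_twistFactor_div {p : ℕ} (hp : p.Prime)
    (hE : (E.baseChange ℚ).IsGlobalMinimal) (hd : Squarefree d) :
    padicValRat p (localFactor E d p / twistFactor E d : ℚ) = 0 := by
  have := Fact.mk hp
  have hprod : ∀ S : Finset ℕ, (∀ q ∈ S, q.Prime ∧ q ≠ p) →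
      (∏ q ∈ S, localFactor E d q) ≠ 0 ∧
        padicValRat p (∏ q ∈ S, localFactor E d q) = 0 := fun S hS => by
    refine Finset.prod_induction _ (fun x : ℚ => x ≠ 0 ∧ padicValRat p x = 0) ?_ ?_ ?_
    · rintro a b ⟨ha, ha'⟩ ⟨hb, hb'⟩
      exact ⟨mul_ne_zero ha hb, by rw [padicValRat.mul ha hb, ha', hb', add_zero]⟩
    · exact ⟨one_ne_zero, padicValRat.one⟩
    · intro q hq
      obtain ⟨hqp, hne⟩ := hS q hq
      have := Fact.mk hqp
      obtain ⟨k, hk⟩ := (localFactor_spec hqp hE hd).2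
      refine ⟨localFactor_ne_zero E d hqp, ?_⟩
      rw [hk, padicValRat.zpow, padicValRat.of_nat, padicValNat_primes hne.symm]
      simp
  have h0 := localFactor_ne_zero E d hp
  have key : ∃ S : Finset ℕ, (∀ q ∈ S, q.Prime ∧ q ≠ p) ∧
      (twistFactor E d : ℚ) = localFactor E d p * ∏ q ∈ S, localFactor E d q := by
    refine ⟨(2 * d).natAbs.primeFactors.erase p, fun q hq => ?_, ?_⟩
    · rw [Finset.mem_erase] at hq
      exact ⟨Nat.prime_of_mem_primeFactors hq.2, hq.1⟩
    · rw [twistFactor, Units.val_mk0]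
      by_cases hmem : p ∈ (2 * d).natAbs.primeFactors
      · exact (Finset.mul_prod_erase _ _ hmem).symm
      · rw [Finset.erase_eq_of_notMem hmem, localFactor_of_notMem hp hd.ne_zero hmem, one_mul]
  obtain ⟨S, hS, hprod'⟩ := key
  obtain ⟨h1, h2⟩ := hprod S hS
  rw [hprod', div_mul_cancel_left₀ h0, padicValRat.inv, h2, neg_zero]

theorem quadraticTwist_c₄ (W : WeierstrassCurve ℚ) (d : ℤ) :
    (W.quadraticTwist d).c₄ = d ^ 2 * W.c₄ := by
  simp only [quadraticTwist, c₄, b₂, b₄]; ring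

theorem quadraticTwist_c₆ (W : WeierstrassCurve ℚ) (d : ℤ) :
    (W.quadraticTwist d).c₆ = d ^ 3 * W.c₆ := by
  simp only [quadraticTwist, c₆, b₂, b₄, b₆]; ring

theorem quadraticTwist_Δ (W : WeierstrassCurve ℚ) (d : ℤ) :
    (W.quadraticTwist d).Δ = d ^ 6 * W.Δ := by
  simp only [quadraticTwist, Δ, b₂, b₄, b₆, b₈]; ring

theorem exists_twistModel_isGlobalMinimal (hE : (E.baseChange ℚ).IsGlobalMinimal)
    (hd : Squarefree d) : ∃ r s t : ℚ, (E.twistModel d r s t).IsGlobalMinimal := by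
  have hu0 : (twistFactor E d : ℚ) ≠ 0 := (twistFactor E d).ne_zero
  have hloc : ∀ p : ℕ, p.Prime →
      LocModel p (d ^ 2 * E.c₄ / twistFactor E d ^ 4) (d ^ 3 * E.c₆ / twistFactor E d ^ 6) ∧
      ¬ LocModel p (d ^ 2 * E.c₄ / twistFactor E d ^ 4 / p ^ 4)
        (d ^ 3 * E.c₆ / twistFactor E d ^ 6 / p ^ 6) := by
    intro p hp
    have := Fact.mk hp
    have h0 := localFactor_ne_zero E d hp
    have hv := padicValRat_twistFactor_div hp hE hd
    -- Both `u_p/ũ` and its inverse are `p`-integral, so `LocModel.mul` transfers local models in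
    -- either direction.
    have hx := not_dvd_den_of_padicValRat_nonneg hp hv.ge
    have hy : ¬ p ∣ ((localFactor E d p / twistFactor E d : ℚ)⁻¹).den :=
      not_dvd_den_of_padicValRat_nonneg hp (by rw [padicValRat.inv, hv, neg_zero])
    obtain ⟨⟨h1, h2⟩, -⟩ := localFactor_spec hp hE hd
    refine ⟨?_, fun h => h2 ?_⟩
    · convert h1.mul hp hx using 1 <;> field_simp
    · convert h.mul hp hy using 1 <;> field_simp
  obtain ⟨W, h4, h6⟩ := exists_of_locModel fun p hp => (hloc p hp).1
  obtain ⟨r, s, t, hC⟩ := exists_smul_eq (W := (E.baseChange ℚ).quadraticTwist d)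
    (W' := W.baseChange ℚ) (twistFactor E d)
    (by rw [quadraticTwist_c₄, baseChange_c₄', baseChange_c₄', h4]; field_simp)
    (by rw [quadraticTwist_c₆, baseChange_c₆', baseChange_c₆', h6]; field_simp)
  refine ⟨r, s, t, ?_⟩
  rw [twistModel, hC]
  apply isGlobalMinimal_of_not_locModel
  · rw [← hC, variableChange_Δ, quadraticTwist_Δ]
    have hΔ : (E.baseChange ℚ).Δ ≠ 0 := hE.isElliptic.isUnit.ne_zero
    have hd0 : (d : ℚ) ≠ 0 := by exact_mod_cast hd.ne_zero
    exact mul_ne_zero (pow_ne_zero _ (Units.ne_zero _)) (mul_ne_zero (pow_ne_zero _ hd0) hΔ)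
  · intro p hp
    rw [h4, h6]
    exact (hloc p hp).2

end LocalFactor

end WeierstrassCurve
end

theorem mainTheorem5 (E : WeierstrassCurve ℤ) (hE : (E.baseChange ℚ).IsGlobalMinimal)
    (d : ℤ) (hd : Squarefree d)
    {K : Type*} [Field K] [Algebra ℚ K] (δ : Kˣ) (hδ : (δ : K) ^ 2 = d) :
    E.twistPullback d δ hδ
        (((E.baseChange ℚ).quadraticTwist d).baseChange K).invariantDifferential =
      (1 / (δ : K)) • ((E.baseChange ℚ).baseChange K).invariantDifferential ∧
    (∃ r s t : ℚ, (E.twistModel d r s t).IsGlobalMinimal) ∧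
    ∀ r s t : ℚ, (E.twistModel d r s t).IsGlobalMinimal →
      E.twistPullback d δ hδ
          (E.modelPullback d r s t ((E.twistModel d r s t).baseChange K).invariantDifferential) =
        (algebraMap ℚ K (E.twistFactor d) / (δ : K)) •
          ((E.baseChange ℚ).baseChange K).invariantDifferential := by
  have h1 : E.twistPullback d δ hδ
      (((E.baseChange ℚ).quadraticTwist d).baseChange K).invariantDifferential =
      (1 / (δ : K)) • ((E.baseChange ℚ).baseChange K).invariantDifferential := by
    rw [WeierstrassCurve.twistPullback, WeierstrassCurve.pullback_invariantDifferential]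
    simp [WeierstrassCurve.twistChange]
  refine ⟨h1, E.exists_twistModel_isGlobalMinimal hE hd, fun r s t _ => ?_⟩
  rw [WeierstrassCurve.modelPullback, WeierstrassCurve.pullback_invariantDifferential, map_smul,
    h1, smul_smul, mul_one_div]
  -- The scaling unit of the base-changed transformation is by definition the image of `ũ` in `K`.
  rfl
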